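/- Let $m,N\ge 1$ be integers, let $\mathbb M^{m\times N}$ be the space of real $m\times N$ matrices, let $Y:=\,]0,1[^N$, and let $W:\mathbb M^{m\times N}\to[0,+\infty]$ be Borel measurable. Let $\mathrm{Aff}_0(Y;\mathbb R^m)$ be the set of all Lipschitz continuous functions $\phi:\overline Y\to\mathbb R^m$ with $\phi=0$ on $\partial Y$ for which there are finitely many disjoint open sets $V_i\subset Y$ with $|Y\setminus\bigcup_i V_i|=0$ and matrices $A_i\in\mathbb M^{m\times N}$ such that $\nabla\phi=A_i$ in $V_i$ for every $i$. For a Borel measurable $f:\mathbb M^{m\times N}\to[0,+\infty]$, put $$\mathcal Zf(\xi):=\inf\Big\{\int_Y f(\xi+\nabla\phi(y))\,dy:\phi\in\mathrm{Aff}_0(Y;\mathbb R^m)\Big\}\qquad(\xi\in\mathbb M^{m\times N}).$$ A Borel measurable $f:\mathbb M^{m\times N}\to[0,+\infty]$ is quasiconvex if $$f(\xi)\le\frac1{|D|}\int_D f(\xi+\nabla\phi(x))\,dx$$ for every $\xi\in\mathbb M^{m\times N}$, every non-empty bounded open set $D\subset\mathbb R^N$ with $|\partial D|=0$ and every $\phi\in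 W^{1,\infty}_0(D;\mathbb R^m):=W^{1,\infty}(D;\mathbb R^m)\cap W^{1,1}_0(D;\mathbb R^m)$. The quasiconvex envelope $\mathcal Qf$ is the greatest quasiconvex function $\mathbb M^{m\times N}\to[0,+\infty]$ that is less than or equal to $f$. If $\mathcal ZW$ is finite, i.e. $\mathcal ZW(\xi)<+\infty$ for all $\xi\in\mathbb M^{m\times N}$, then $\mathcal ZW$ is Borel measurable, the quasiconvex envelopes of $W$ and of $\mathcal ZW$ exist, and $$\mathcal QW=\mathcal Q[\mathcal ZW]=\mathcal ZW.$$ If, moreover, $N=1$, then $\mathcal ZW=W^{**}$, where $W^{**}$ is the lower semicontinuous convex envelope of $W$, i.e. the greatest lower semicontinuous convex function that is less than or equal to $W$. -/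

import Mathlib

open MeasureTheory Filter Topology Set
open scoped NNReal ENNReal ContDiff

/-- `ℝⁿ` with its Euclidean structure. -/
abbrev Euc (n : ℕ) : Type := EuclideanSpace ℝ (Fin n)

/-- The space `𝕄^{m×N}` of real `m × N` matrices, seen as the linear maps `ℝᴺ → ℝᵐ`, so that the
gradient of a map `ℝᴺ → ℝᵐ` is its Fréchet derivative. -/
abbrev Mat (m N : ℕ) : Type := Euc N →L[ℝ] Euc m

/-- The open unit cube `Y = ]0,1[ᴺ`. -/
def unitCube (N : ℕ) : Set (Euc N) := {x | ∀ i, 0 < x i ∧ x i < 1}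

/-- `Aff₀(D;ℝᵐ)`: the continuous (indeed Lipschitz) piecewise affine functions on `D` which vanish
on `∂D`. Piecewise affine: there are finitely many disjoint open subsets `V i` of `D`, covering `D`
up to a null set, on each of which the gradient is a constant matrix `A i`. The `V i` need not be
connected. (For a merely continuous function, these conditions would allow Cantor-type functions,
which are not in any Sobolev space.) Only the values on the closure of `D` matter. -/
structure IsAffZero {m N : ℕ} (D : Set (Euc N)) (φ : Euc N → Euc m) : Prop where
  lipschitz : ∃ K : ℝ≥0, LipschitzOnWith K φ (closure D)
  pieces : ∃ (k : ℕ) (V : Fin k → Set (Euc N)) (A : Fin k → Mat m N),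
    (∀ i, IsOpen (V i) ∧ V i ⊆ D) ∧ (∀ i j, i ≠ j → Disjoint (V i) (V j)) ∧
    volume (D \ ⋃ i, V i) = 0 ∧ ∀ i, ∀ x ∈ V i, HasFDerivAt φ (A i) x
  boundary : ∀ x ∈ frontier D, φ x = 0

/-- `𝒵f(ξ) = inf { ∫_Y f(ξ + ∇φ(y)) dy : φ ∈ Aff₀(Y;ℝᵐ) }`. -/
noncomputable def ZEnv {m N : ℕ} (f : Mat m N → ℝ≥0∞) (ξ : Mat m N) : ℝ≥0∞ :=
  ⨅ (φ : Euc N → Euc m) (_ : IsAffZero (unitCube N) φ),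
    ∫⁻ y in unitCube N, f (ξ + fderiv ℝ φ y)

/-- `ψ ∈ C_c^∞(D;F)`. -/
def IsTestFun {N : ℕ} {F : Type*} [NormedAddCommGroup F] [NormedSpace ℝ F]
    (D : Set (Euc N)) (ψ : Euc N → F) : Prop :=
  ContDiff ℝ ∞ ψ ∧ HasCompactSupport ψ ∧ tsupport ψ ⊆ D

/-- `φ ∈ W^{1,∞}(D;ℝᵐ)` with weak gradient `G`. -/
structure IsSobolevInfty {m N : ℕ} (D : Set (Euc N)) (φ : Euc N → Euc m) (G : Euc N → Mat m N) :
    Prop where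
  memLp : MemLp φ ∞ (volume.restrict D)
  memLp_grad : MemLp G ∞ (volume.restrict D)
  weak_grad : ∀ η : Euc N → ℝ, IsTestFun D η → ∀ v : Euc N,
    ∫ x in D, (fderiv ℝ η x v) • φ x = - ∫ x in D, η x • G x v

/-- `φ ∈ W^{1,1}_0(D;ℝᵐ)` with gradient `G`: the pair `(φ, G)` is a limit in `L¹(D)` of pairs
`(ψ, ∇ψ)` with `ψ ∈ C_c^∞(D;ℝᵐ)`. -/
def IsSobolevOneZero {m N : ℕ} (D : Set (Euc N)) (φ : Euc N → Euc m) (G : Euc N → Mat m N) :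
    Prop :=
  ∃ ψ : ℕ → Euc N → Euc m, (∀ n, IsTestFun D (ψ n)) ∧
    Tendsto (fun n => eLpNorm (fun x => ψ n x - φ x) 1 (volume.restrict D)) atTop (𝓝 0) ∧
    Tendsto (fun n => eLpNorm (fun x => fderiv ℝ (ψ n) x - G x) 1 (volume.restrict D))
      atTop (𝓝 0)

/-- `φ ∈ W^{1,∞}_0(D;ℝᵐ) = W^{1,∞}(D;ℝᵐ) ∩ W^{1,1}_0(D;ℝᵐ)` with weak gradient `G`. -/
def IsSobolevInftyZero {m N : ℕ} (D : Set (Euc N)) (φ : Euc N → Euc m) (G : Euc N → Mat m N) :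
    Prop :=
  IsSobolevInfty D φ G ∧ IsSobolevOneZero D φ G

/-- Quasiconvexity (in the sense of Morrey) of a Borel function `f : 𝕄^{m×N} → [0,∞]`. -/
structure IsQuasiconvex {m N : ℕ} (f : Mat m N → ℝ≥0∞) : Prop where
  measurable : Measurable f
  le_average : ∀ (ξ : Mat m N) (D : Set (Euc N)), IsOpen D → D.Nonempty → Bornology.IsBounded D →
    volume (frontier D) = 0 → ∀ (φ : Euc N → Euc m) (G : Euc N → Mat m N),
      IsSobolevInftyZero D φ G → f ξ ≤ (volume D)⁻¹ * ∫⁻ x in D, f (ξ + G x)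

/-- The quasiconvex functions `𝕄^{m×N} → [0,∞]` which are less than or equal to `f`. -/
def quasiconvexMinorants {m N : ℕ} (f : Mat m N → ℝ≥0∞) : Set (Mat m N → ℝ≥0∞) :=
  {g | IsQuasiconvex g ∧ g ≤ f}

/-- The quasiconvex envelope `𝒬f`: the pointwise supremum of the quasiconvex minorants of `f`
(it is the greatest one as soon as there is a greatest one). -/
noncomputable def QEnv {m N : ℕ} (f : Mat m N → ℝ≥0∞) : Mat m N → ℝ≥0∞ :=
  sSup (quasiconvexMinorants f)

/-- The lower semicontinuous convex envelope `f**`: the pointwise supremum, hence the greatest, of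
the lower semicontinuous convex functions less than or equal to `f`. As `f ≥ 0`, it is enough to
consider functions with values in `[0,∞]`; convexity of such functions is
`g (aξ + bη) ≤ a g(ξ) + b g(η)` for all `a, b ≥ 0` with `a + b = 1`. -/
noncomputable def lscConvexEnv {m N : ℕ} (f : Mat m N → ℝ≥0∞) : Mat m N → ℝ≥0∞ :=
  sSup {g | LowerSemicontinuous g ∧ ConvexOn ℝ≥0 univ g ∧ g ≤ f}

/-! The zero function is admissible, so `ZEnv W ≤ W`. A quasiconvex `g ≤ W` lies below `ZEnv W`,
because piecewise affine functions vanishing off the cube belong to `W^{1,∞}_0`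
(`PWA.isSobolevInftyZero`, `IsQuasiconvex.le_zEnv`). Hence everything rests on the quasiconvexity of
`ZEnv W`: it is then the greatest quasiconvex minorant both of `W` and of itself.

Quasiconvexity is reached in three stages. For piecewise affine `φ` on any `D` (`affQC_zEnv`), a
Vitali covering fills each piece of `φ` with small copies of the cube carrying almost optimal
functions; the function so obtained on `D` is copied in turn into the cube, where it competes in the
infimum defining `ZEnv W ξ`. Next, tents over long boxes give convexity along every `a ⊗ e_j`
(`AffQC.convex_rankOne`), and a finite nonnegative function which is convex in each matrix entry is
continuous (`AffQC.continuous`). Finally (`AffQC.isQuasiconvex`), a function of `W^{1,∞}_0` is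
extended by zero, mollified, and interpolated on Kuhn's triangulations; at both approximations the
gradients are bounded and converge almost everywhere, so that dominated convergence carries the
inequality over to the limit.

If `N = 1`, every matrix has the form `a ⊗ e_0`, so `ZEnv W` is convex and continuous. Conversely,
gradients of admissible functions have mean zero, and Jensen's inequality places every convex
minorant of `W` below `ZEnv W`. -/

/-- A globally Lipschitz map, zero off `D`, with gradient `A i` on the open piece `V i`. -/
structure PWA {m N : ℕ} (D : Set (Euc N)) {ι : Type} (V : ι → Set (Euc N)) (A : ι → Mat m N)
    (φ : Euc N → Euc m) : Prop where
  lip : ∃ K : ℝ≥0, LipschitzWith K φ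
  zero : ∀ x, x ∉ D → φ x = 0
  isOpen : ∀ i, IsOpen (V i)
  subset : ∀ i, V i ⊆ D
  disj : Pairwise fun i j => Disjoint (V i) (V j)
  null : volume (D \ ⋃ i, V i) = 0
  deriv : ∀ i, ∀ x ∈ V i, HasFDerivAt φ (A i) x

/-! ### Piecewise affine functions: extension by zero, integrals, gluing. -/

section basic
variable {m N : ℕ} {D : Set (Euc N)}

/-- A point of the complement nearest to a given point of `D` lies on the frontier, where `φ`
vanishes; so extending by zero does not increase the Lipschitz constant. -/
lemma IsAffZero.lipschitz_indicator {φ : Euc N → Euc m} (h : IsAffZero D φ) (hD : D ≠ univ)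
    : ∃ K : ℝ≥0, LipschitzWith K (D.indicator φ) := by
  obtain ⟨K, hK⟩ := h.lipschitz
  refine ⟨K, ?_⟩
  have key : ∀ x ∈ D, ∀ y ∉ D, ‖φ x‖ ≤ K * dist x y := by
    intro x hx y hy
    obtain ⟨z, hz, hzd⟩ := exists_mem_frontier_infDist_compl_eq_dist hx hD
    have h1 : dist (φ x) (φ z) ≤ K * dist x z :=
      hK.dist_le_mul x (subset_closure hx) z (frontier_subset_closure hz)
    rw [h.boundary z hz, dist_zero_right, ← hzd] at h1
    exact h1.trans (mul_le_mul_of_nonneg_left (Metric.infDist_le_dist_of_mem hy) K.2)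
  refine LipschitzWith.of_dist_le_mul fun x y => ?_
  by_cases hx : x ∈ D <;> by_cases hy : y ∈ D
  · simpa [hx, hy] using hK.dist_le_mul x (subset_closure hx) y (subset_closure hy)
  · simpa [hx, hy] using key x hx y hy
  · simpa [hx, hy, dist_comm] using key y hy x hx
  · simp only [hx, hy, not_false_eq_true, indicator_of_notMem, dist_self]
    positivity

lemma IsAffZero.exists_pwa {φ : Euc N → Euc m} (h : IsAffZero D φ) (hD : D ≠ univ)
    (hDo : IsOpen D) :
    ∃ (k : ℕ) (V : Fin k → Set (Euc N)) (A : Fin k → Mat m N), PWA D V A (D.indicator φ) := by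
  obtain ⟨k, V, A, h1, h2, h3, h4⟩ := h.pieces
  refine ⟨k, V, A, h.lipschitz_indicator hD, fun x hx => by simp [hx], fun i => (h1 i).1,
    fun i => (h1 i).2, fun i j => h2 i j, h3, fun i x hx => ?_⟩
  refine (h4 i x hx).congr_of_eventuallyEq ?_
  filter_upwards [hDo.mem_nhds ((h1 i).2 hx)] with y hy
  simp [hy]

lemma PWA.isAffZero {ι : Type} [Fintype ι] {V : ι → Set (Euc N)} {A : ι → Mat m N}
    {φ : Euc N → Euc m} (h : PWA D V A φ) (hDo : IsOpen D) : IsAffZero D φ := by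
  obtain ⟨K, hK⟩ := h.lip
  let e := (Fintype.equivFin ι).symm
  refine ⟨⟨K, hK.lipschitzOnWith⟩, ⟨Fintype.card ι, V ∘ e, A ∘ e,
    fun i => ⟨h.isOpen _, h.subset _⟩, fun i j hij => h.disj (e.injective.ne hij), ?_,
    fun i x hx => h.deriv _ x hx⟩, fun x hx => h.zero x ?_⟩
  · have : (⋃ i, (V ∘ e) i) = ⋃ i, V i := e.surjective.iUnion_comp V
    rw [this]; exact h.null
  · rw [hDo.frontier_eq] at hx; exact hx.2

lemma PWA.measure_iUnion {ι : Type} [Fintype ι] {V : ι → Set (Euc N)} {A : ι → Mat m N}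
    {φ : Euc N → Euc m} (h : PWA D V A φ) : (⋃ i, V i : Set (Euc N)) =ᵐ[volume] D := by
  refine (LE.le.eventuallyLE (iUnion_subset h.subset)).antisymm ?_
  exact ae_le_set.2 h.null

lemma PWA.sum_measure {ι : Type} [Fintype ι] {V : ι → Set (Euc N)} {A : ι → Mat m N}
    {φ : Euc N → Euc m} (h : PWA D V A φ) : ∑ i, volume (V i) = volume D := by
  rw [← measure_congr h.measure_iUnion, MeasureTheory.measure_iUnion h.disj
    fun i => (h.isOpen i).measurableSet, tsum_fintype]

lemma PWA.lintegral {ι : Type} [Fintype ι] {V : ι → Set (Euc N)} {A : ι → Mat m N}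
    {φ : Euc N → Euc m} (h : PWA D V A φ) (F : Mat m N → ℝ≥0∞) :
    ∫⁻ x in D, F (fderiv ℝ φ x) = ∑ i, volume (V i) * F (A i) := by
  rw [← setLIntegral_congr h.measure_iUnion, lintegral_iUnion
    (fun i => (h.isOpen i).measurableSet) h.disj, tsum_fintype]
  refine Finset.sum_congr rfl fun i _ => ?_
  rw [setLIntegral_congr_fun (g := fun _ => F (A i)) (h.isOpen i).measurableSet
    (fun x hx => by simp only [(h.deriv i x hx).fderiv]), setLIntegral_const, mul_comm]

/-- The constant does not depend on the number of pieces: for points in two different pieces, each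
of the two functions vanishes at the other's point, which costs only a factor `2`. -/
lemma exists_lipschitz_glue {X F : Type*} [PseudoMetricSpace X] [NormedAddCommGroup F]
    {κ : Type*} (T : κ → Set X) (hT : Pairwise fun p q => Disjoint (T p) (T q))
    (g : κ → X → F) (K : ℝ≥0) (hg : ∀ p, LipschitzWith K (g p))
    (hz : ∀ p, ∀ x, x ∉ T p → g p x = 0) :
    ∃ G : X → F, LipschitzWith (2 * K) G ∧ (∀ p, ∀ x ∈ T p, G x = g p x) ∧
      ∀ x, (∀ p, x ∉ T p) → G x = 0 := by
  classical
  let G : X → F := fun x => if h : ∃ p, x ∈ T p then g h.choose x else 0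
  have hG1 : ∀ p, ∀ x ∈ T p, G x = g p x := by
    intro p x hx
    have h : ∃ p, x ∈ T p := ⟨p, hx⟩
    have : h.choose = p := by
      by_contra hne
      exact (Set.disjoint_left.1 (hT hne)) h.choose_spec hx
    simp only [G, dif_pos h, this]
  have hG0 : ∀ x, (∀ p, x ∉ T p) → G x = 0 := by
    intro x hx
    have h : ¬ ∃ p, x ∈ T p := by push Not; exact hx
    simp only [G, dif_neg h]
  have hK2 : ∀ x y : X, (K : ℝ) * dist x y ≤ 2 * K * dist x y := fun x y => by
    have : 0 ≤ (K : ℝ) * dist x y := by positivity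
    linarith
  have key : ∀ p x y, x ∈ T p → (∀ q, y ∉ T q) → dist (G x) (G y) ≤ 2 * K * dist x y := by
    intro p x y hx hy
    rw [hG1 p x hx, hG0 y hy, ← hz p y (hy p)]
    exact ((hg p).dist_le_mul x y).trans (hK2 x y)
  refine ⟨G, LipschitzWith.of_dist_le_mul fun x y => ?_, hG1, hG0⟩
  push_cast
  by_cases hx : ∃ p, x ∈ T p <;> by_cases hy : ∃ p, y ∈ T p
  · obtain ⟨p, hp⟩ := hx
    obtain ⟨q, hq⟩ := hy
    rw [hG1 p x hp, hG1 q y hq]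
    by_cases hpq : p = q
    · subst hpq
      exact ((hg p).dist_le_mul x y).trans (hK2 x y)
    · have e1 : g p y = 0 := hz p y fun h => Set.disjoint_left.1 (hT hpq) h hq
      have e2 : g q x = 0 := hz q x fun h => Set.disjoint_left.1 (hT hpq) hp h
      have h1 := (hg p).dist_le_mul x y
      have h2 := (hg q).dist_le_mul x y
      rw [e1, dist_zero_right] at h1
      rw [e2, dist_zero_left] at h2
      rw [dist_eq_norm]
      have := norm_sub_le (g p x) (g q y)
      linarith
  · obtain ⟨p, hp⟩ := hx
    push Not at hy
    exact key p x y hp hy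
  · obtain ⟨p, hp⟩ := hy
    push Not at hx
    rw [dist_comm, dist_comm x]
    exact key p y x hp hx
  · push Not at hx hy
    rw [hG0 x hx, hG0 y hy, dist_self]
    positivity

end basic

/-! ### Vitali coverings by scaled copies of a set. -/

/-- The affine map sending `a + r E` to `E`. -/
noncomputable def scl {N : ℕ} (p : Euc N × ℝ) (x : Euc N) : Euc N := p.2⁻¹ • (x - p.1)

section tiling
variable {m N : ℕ}

lemma continuous_scl (p : Euc N × ℝ) : Continuous (scl p) := by
  unfold scl; fun_prop

lemma volume_scl_preimage {p : Euc N × ℝ} (hp : 0 < p.2) (S : Set (Euc N)) :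
    volume (scl p ⁻¹' S) = ENNReal.ofReal (p.2 ^ N) * volume S := by
  have : scl p ⁻¹' S = (fun x => x + (-p.1)) ⁻¹' ((fun x => p.2⁻¹ • x) ⁻¹' S) := by
    ext x; simp [scl, sub_eq_add_neg]
  rw [this, measure_preimage_add_right, Measure.addHaar_preimage_smul _ (inv_ne_zero hp.ne')]
  simp [abs_of_pos hp]

/-- Vitali's theorem for the closed sets `a + r (closure E)` contained in some `V i`. Such a set is
comparable to a ball, with the scale-invariant constant `|B(0,3ρ)| / |E|`. Since `∂E` is null, the
closures may be replaced by `E` afterwards. -/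
lemma exists_tiling {E : Set (Euc N)} (hEo : IsOpen E) (hEne : E.Nonempty)
    (hEb : Bornology.IsBounded E) (hEf : volume (frontier E) = 0) {ι : Type*}
    (V : ι → Set (Euc N)) (hV : ∀ i, IsOpen (V i)) :
    ∃ u : Set (Euc N × ℝ), u.Countable ∧
      (∀ p ∈ u, 0 < p.2 ∧ ∃ i, scl p ⁻¹' closure E ⊆ V i) ∧
      (u.PairwiseDisjoint fun p => scl p ⁻¹' closure E) ∧
      volume ((⋃ i, V i) \ ⋃ p ∈ u, scl p ⁻¹' E) = 0 := by
  obtain ⟨ρ, hρ, hEρ⟩ : ∃ ρ : ℝ, 0 < ρ ∧ closure E ⊆ Metric.closedBall 0 ρ := by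
    obtain ⟨ρ, h1, h2⟩ := hEb.closure.subset_closedBall_lt 0 0
    exact ⟨ρ, h1, h2⟩
  have hE0 : volume E ≠ 0 := (hEo.measure_pos volume hEne).ne'
  have hEt : volume E ≠ ⊤ := hEb.measure_lt_top.ne
  let t : Set (Euc N × ℝ) := {p | 0 < p.2 ∧ ∃ i, scl p ⁻¹' closure E ⊆ V i}
  have hball : ∀ (p : Euc N × ℝ), 0 < p.2 → ∀ R : ℝ,
      scl p ⁻¹' Metric.closedBall 0 R = Metric.closedBall p.1 (p.2 * R) := by
    intro p hp R
    ext x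
    rw [mem_preimage, mem_closedBall_zero_iff, mem_closedBall_iff_norm, scl, norm_smul, norm_inv,
      Real.norm_eq_abs, abs_of_pos hp, inv_mul_le_iff₀ hp]
  obtain ⟨u, hut, huc, hud, hun⟩ := Vitali.exists_disjoint_covering_ae volume (⋃ i, V i) t
    (volume (Metric.closedBall (0 : Euc N) (3 * ρ)) / volume E).toNNReal
    (fun p => p.2 * ρ) (fun p => p.1) (fun p => scl p ⁻¹' closure E)
    (fun p hp => by
      rw [← hball p hp.1]; exact preimage_mono hEρ)
    (fun p hp => by
      rw [show 3 * (p.2 * ρ) = p.2 * (3 * ρ) by ring, ← hball p hp.1, volume_scl_preimage hp.1,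
        ENNReal.coe_toNNReal (ENNReal.div_ne_top measure_closedBall_lt_top.ne hE0),
        volume_scl_preimage hp.1]
      calc ENNReal.ofReal (p.2 ^ N) * volume (Metric.closedBall (0 : Euc N) (3 * ρ))
          = volume (Metric.closedBall (0 : Euc N) (3 * ρ)) / volume E *
              (ENNReal.ofReal (p.2 ^ N) * volume E) := by
            rw [mul_left_comm, ENNReal.div_mul_cancel hE0 hEt]
        _ ≤ _ := by gcongr; exact subset_closure)
    (fun p hp => by
      have h1 : scl p ⁻¹' E ⊆ interior (scl p ⁻¹' closure E) :=
        interior_maximal (preimage_mono subset_closure) (hEo.preimage (continuous_scl p))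
      refine Nonempty.mono h1 ?_
      obtain ⟨e, he⟩ := hEne
      refine ⟨p.1 + p.2 • e, ?_⟩
      simp only [scl, mem_preimage, add_sub_cancel_left]
      rw [smul_smul, inv_mul_cancel₀ hp.1.ne', one_smul]; exact he)
    (fun p hp => isClosed_closure.preimage (continuous_scl p))
    (fun x hx ε hε => by
      obtain ⟨i, hi⟩ := mem_iUnion.1 hx
      obtain ⟨δ, hδ, hδV⟩ := Metric.isOpen_iff.1 (hV i) x hi
      have hmin : 0 < min ε (δ / 2) := lt_min hε (by positivity)
      refine ⟨(x, min ε (δ / 2) / ρ), ⟨by positivity, i, ?_⟩, ?_, rfl⟩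
      · refine (preimage_mono hEρ).trans ?_
        rw [hball _ (by positivity)]
        refine (Metric.closedBall_subset_ball ?_).trans hδV
        simp only [div_mul_cancel₀ _ hρ.ne']
        have := min_le_right ε (δ / 2); linarith
      · simp only [div_mul_cancel₀ _ hρ.ne']
        exact min_le_left _ _)
  refine ⟨u, huc, fun p hp => hut hp, hud, ?_⟩
  have hsub : (⋃ i, V i) \ ⋃ p ∈ u, scl p ⁻¹' E ⊆
      ((⋃ i, V i) \ ⋃ p ∈ u, scl p ⁻¹' closure E) ∪ ⋃ p ∈ u, scl p ⁻¹' frontier E := by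
    rintro x ⟨hx, hx'⟩
    by_cases h : x ∈ ⋃ p ∈ u, scl p ⁻¹' closure E
    · right
      simp only [mem_iUnion, mem_preimage, exists_prop] at h hx' ⊢
      obtain ⟨p, hp, hxp⟩ := h
      refine ⟨p, hp, ?_⟩
      rw [hEo.frontier_eq]
      exact ⟨hxp, fun h => hx' ⟨p, hp, h⟩⟩
    · exact Or.inl ⟨hx, h⟩
  refine measure_mono_null hsub (measure_union_null hun ?_)
  refine (measure_biUnion_null_iff huc).2 fun p hp => ?_
  rw [volume_scl_preimage (hut hp).1, hEf, mul_zero]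

/-- Fill every piece of `φ` with copies of piecewise affine functions on `E`. -/
theorem PWA.refine {D E : Set (Euc N)} {ι : Type} [Fintype ι] {κ : ι → Type}
    [∀ i, Fintype (κ i)] {V : ι → Set (Euc N)} {A : ι → Mat m N} {φ : Euc N → Euc m}
    (h : PWA D V A φ) (hEo : IsOpen E) (hEne : E.Nonempty)
    (hEb : Bornology.IsBounded E) (hEf : volume (frontier E) = 0)
    {U : ∀ i, κ i → Set (Euc N)} {B : ∀ i, κ i → Mat m N} {ψ : ι → Euc N → Euc m}
    (hψ : ∀ i, PWA E (U i) (B i) (ψ i)) :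
    ∃ (V' : (Σ i, κ i) → Set (Euc N)) (φ' : Euc N → Euc m),
      PWA D V' (fun s => A s.1 + B s.1 s.2) φ' ∧
      ∀ s, volume (V' s) * volume E = volume (V s.1) * volume (U s.1 s.2) := by
  obtain ⟨u, huc, hu, hud, hun⟩ := exists_tiling hEo hEne hEb hEf V h.isOpen
  have hpos : ∀ p : u, 0 < p.1.2 := fun p => (hu p p.2).1
  choose j hj using fun p : u => (hu p p.2).2
  choose K hK using fun i => (hψ i).lip
  obtain ⟨L, hL⟩ := h.lip
  have : Countable u := huc.to_subtype
  let T : u → Set (Euc N) := fun p => scl p.1 ⁻¹' E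
  have hTV : ∀ p : u, T p ⊆ V (j p) := fun p => (preimage_mono subset_closure).trans (hj p)
  have hTo : ∀ p, IsOpen (T p) := fun p => hEo.preimage (continuous_scl _)
  have hTd : Pairwise fun p q : u => Disjoint (T p) (T q) := fun p q hpq =>
    (hud p.2 q.2 (fun h => hpq (Subtype.ext h))).mono (preimage_mono subset_closure)
      (preimage_mono subset_closure)
  -- The scaling `r ψ((x - a) / r)` preserves both gradients and Lipschitz constants, so one
  -- constant serves for all copies.
  let g : u → Euc N → Euc m := fun p x => p.1.2 • ψ (j p) (scl p.1 x)
  have hg : ∀ p, LipschitzWith (∑ i, K i) (g p) := by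
    intro p
    refine LipschitzWith.of_dist_le_mul fun x y => ?_
    have h1 := (hK (j p)).dist_le_mul (scl p.1 x) (scl p.1 y)
    have h2 : dist (scl p.1 x) (scl p.1 y) = p.1.2⁻¹ * dist x y := by
      simp only [scl, dist_eq_norm]
      rw [← smul_sub, norm_smul, sub_sub_sub_cancel_right, Real.norm_eq_abs,
        abs_of_pos (inv_pos.2 (hpos p))]
    have h3 : K (j p) ≤ ∑ i, K i := Finset.single_le_sum (fun _ _ => zero_le) (Finset.mem_univ _)
    simp only [g, dist_smul₀, Real.norm_eq_abs, abs_of_pos (hpos p)]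
    rw [h2] at h1
    calc p.1.2 * dist (ψ (j p) (scl p.1 x)) (ψ (j p) (scl p.1 y))
        ≤ p.1.2 * (K (j p) * (p.1.2⁻¹ * dist x y)) := mul_le_mul_of_nonneg_left h1 (hpos p).le
      _ = K (j p) * dist x y := by have := (hpos p).ne'; field_simp
      _ ≤ _ := by gcongr
  have hgz : ∀ p, ∀ x, x ∉ T p → g p x = 0 := fun p x hx => by
    simp only [g, (hψ (j p)).zero _ hx, smul_zero]
  obtain ⟨G, hGl, hG1, hG0⟩ := exists_lipschitz_glue T hTd g _ hg hgz
  -- There may be infinitely many tiles; uniting all copies of the same piece keeps the index set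
  -- finite.
  let V' : (Σ i, κ i) → Set (Euc N) := fun s =>
    ⋃ p : {p : u // j p = s.1}, scl p.1.1 ⁻¹' U s.1 s.2
  have hUT : ∀ (p : u) i (k : κ i), scl p.1 ⁻¹' U i k ⊆ T p := fun p i k =>
    preimage_mono ((hψ i).subset k)
  have hUo : ∀ (p : u) i (k : κ i), IsOpen (scl p.1 ⁻¹' U i k) := fun p i k =>
    ((hψ i).isOpen k).preimage (continuous_scl _)
  refine ⟨V', fun x => φ x + G x, ⟨⟨_, hL.add hGl⟩, fun x hx => ?_, fun s =>
    isOpen_iUnion fun p => hUo _ _ _, fun s => iUnion_subset fun p => ?_, ?_, ?_, ?_⟩, ?_⟩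
  · rw [h.zero x hx, hG0 x fun p hp => hx (h.subset _ (hTV p hp)), add_zero]
  · exact (hUT _ _ _).trans ((hTV _).trans (h.subset _))
  · rintro ⟨i, k⟩ ⟨i', k'⟩ hne
    change Disjoint (⋃ p : {p : u // j p = i}, scl p.1.1 ⁻¹' U i k)
      (⋃ p : {p : u // j p = i'}, scl p.1.1 ⁻¹' U i' k')
    refine disjoint_iUnion_left.2 ?_
    rintro ⟨p, rfl⟩
    refine disjoint_iUnion_right.2 ?_
    rintro ⟨q, rfl⟩
    by_cases hpq : p = q
    · subst hpq
      have : k ≠ k' := fun h => hne (by rw [h])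
      exact ((hψ (j p)).disj this).preimage _
    · exact (hTd hpq).mono (hUT p _ k) (hUT q _ k')
  · have hsub : D \ ⋃ s, V' s ⊆ (D \ ⋃ i, V i) ∪ ((⋃ i, V i) \ ⋃ p ∈ u, scl p ⁻¹' E) ∪
        ⋃ p : u, scl p.1 ⁻¹' (E \ ⋃ k, U (j p) k) := by
      rintro x ⟨hxD, hx⟩
      by_cases h1 : x ∈ ⋃ i, V i
      · by_cases h2 : x ∈ ⋃ p ∈ u, scl p ⁻¹' E
        · right
          simp only [mem_iUnion, exists_prop] at h2
          obtain ⟨p, hp, hxp⟩ := h2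
          refine mem_iUnion.2 ⟨⟨p, hp⟩, hxp, fun h3 => hx ?_⟩
          obtain ⟨k, hk⟩ := mem_iUnion.1 h3
          exact mem_iUnion.2 ⟨⟨j ⟨p, hp⟩, k⟩, mem_iUnion.2 ⟨⟨⟨p, hp⟩, rfl⟩, hk⟩⟩
        · exact Or.inl (Or.inr ⟨h1, h2⟩)
      · exact Or.inl (Or.inl ⟨hxD, h1⟩)
    refine measure_mono_null hsub (measure_union_null (measure_union_null h.null hun) ?_)
    refine measure_iUnion_null fun p => ?_
    rw [volume_scl_preimage (hpos p), (hψ _).null, mul_zero]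
  · rintro ⟨i, k⟩ x hx
    simp only [V'] at hx
    obtain ⟨⟨p, rfl⟩, hxp⟩ := mem_iUnion.1 hx
    have hxT : x ∈ T p := hUT _ _ _ hxp
    have h1 : HasFDerivAt (g p) (B (j p) k) x := by
      have h2 : HasFDerivAt (scl p.1) (p.1.2⁻¹ • ContinuousLinearMap.id ℝ (Euc N)) x :=
        ((hasFDerivAt_id x).sub_const p.1.1).const_smul p.1.2⁻¹
      have h3 := (((hψ (j p)).deriv k _ hxp).comp x h2).const_smul p.1.2
      have h4 : p.1.2 • (B (j p) k).comp (p.1.2⁻¹ • ContinuousLinearMap.id ℝ (Euc N)) =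
          B (j p) k := by
        ext y i
        simp [(hpos p).ne']
      rw [h4] at h3
      exact h3
    have h2 : HasFDerivAt G (B (j p) k) x := by
      refine h1.congr_of_eventuallyEq ?_
      filter_upwards [(hTo p).mem_nhds hxT] with y hy using hG1 p y hy
    exact (h.deriv _ x (hTV p hxT)).add h2
  · rintro ⟨i, k⟩
    -- Both volumes are multiples of the same series `∑ r ^ N`, once with factor `|U i k|`, once
    -- with factor `|E|`.
    have e1 : volume (V' ⟨i, k⟩) =
        ∑' p : {p : u // j p = i}, ENNReal.ofReal (p.1.1.2 ^ N) * volume (U i k) := by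
      simp only [V']
      rw [MeasureTheory.measure_iUnion]
      · exact tsum_congr fun p => volume_scl_preimage (hpos _) _
      · intro p q hpq
        exact (hTd (fun h => hpq (Subtype.ext h))).mono (hUT _ _ _) (hUT _ _ _)
      · exact fun p => (hUo _ _ _).measurableSet
    have e2 : volume (V i) =
        ∑' p : {p : u // j p = i}, ENNReal.ofReal (p.1.1.2 ^ N) * volume E := by
      have : volume (V i) = volume (⋃ p : {p : u // j p = i}, T p.1) := by
        refine measure_congr (EventuallyLE.antisymm ?_ ?_)
        · refine ae_le_set.2 (measure_mono_null ?_ hun)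
          rintro x ⟨hx, hx'⟩
          refine ⟨mem_iUnion.2 ⟨i, hx⟩, fun h2 => hx' ?_⟩
          simp only [mem_iUnion, exists_prop] at h2
          obtain ⟨p, hp, hxp⟩ := h2
          have hji : j ⟨p, hp⟩ = i := by
            by_contra hne
            exact Set.disjoint_left.1 (h.disj hne) (hTV ⟨p, hp⟩ hxp) hx
          exact mem_iUnion.2 ⟨⟨⟨p, hp⟩, hji⟩, hxp⟩
        · refine LE.le.eventuallyLE (iUnion_subset ?_)
          rintro ⟨p, rfl⟩
          exact hTV p
      rw [this, MeasureTheory.measure_iUnion]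
      · exact tsum_congr fun p => volume_scl_preimage (hpos _) _
      · intro p q hpq
        exact hTd (fun h => hpq (Subtype.ext h))
      · exact fun p => (hTo _).measurableSet
    rw [e1, e2, ENNReal.tsum_mul_right, ENNReal.tsum_mul_right, mul_assoc, mul_assoc,
      mul_comm (volume E)]

end tiling

/-! ### Boxes and the unit cube. -/

/-- The open box with corners `α` and `β`. -/
def openBox {N : ℕ} (α β : Fin N → ℝ) : Set (Euc N) := {x | ∀ i, α i < x i ∧ x i < β i}

section box
variable {N : ℕ} (α β : Fin N → ℝ)

lemma unitCube_eq_openBox : unitCube N = openBox (fun _ => 0) (fun _ => 1) := rfl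

lemma openBox_eq_preimage :
    openBox α β = (WithLp.ofLp : Euc N → Fin N → ℝ) ⁻¹' (univ.pi fun i => Ioo (α i) (β i)) := by
  ext x; simp [openBox]

lemma isOpen_openBox : IsOpen (openBox α β) := by
  rw [openBox_eq_preimage]
  exact (isOpen_set_pi finite_univ fun i _ => isOpen_Ioo).preimage (PiLp.continuous_ofLp 2 _)

lemma convex_openBox : Convex ℝ (openBox α β) := by
  intro x hx y hy a b ha hb hab i
  obtain ⟨h1, h2⟩ := hx i
  obtain ⟨h3, h4⟩ := hy i
  exact (convex_Ioo (α i) (β i)) ⟨h1, h2⟩ ⟨h3, h4⟩ ha hb hab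

lemma volume_frontier_openBox : volume (frontier (openBox α β)) = 0 :=
  (convex_openBox α β).addHaar_frontier _

lemma isBounded_openBox : Bornology.IsBounded (openBox α β) := by
  have h : Bornology.IsBounded (univ.pi fun i => Ioo (α i) (β i)) :=
    Bornology.IsBounded.pi fun i => Metric.isBounded_Ioo _ _
  rw [openBox_eq_preimage]
  exact (PiLp.antilipschitzWith_ofLp 2 (fun _ : Fin N => ℝ)).isBounded_preimage h

lemma volume_openBox : volume (openBox α β) = ∏ i, ENNReal.ofReal (β i - α i) := by
  rw [openBox_eq_preimage, (PiLp.volume_preserving_ofLp (Fin N)).measure_preimage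
    (MeasurableSet.univ_pi fun i => measurableSet_Ioo).nullMeasurableSet, Real.volume_pi_Ioo]

lemma volume_openBox_slab {j : Fin N} {s t : ℝ} {S : Set (Euc N)}
    (hS : ∀ x ∈ S, x ∈ openBox α β ∧ s < x j ∧ x j < t) :
    volume S * ENNReal.ofReal (β j - α j) ≤ volume (openBox α β) * ENNReal.ofReal (t - s) := by
  classical
  have h1 : S ⊆ openBox (Function.update α j s) (Function.update β j t) := by
    intro x hx i
    obtain ⟨h1, h2, h3⟩ := hS x hx
    by_cases hi : i = j
    · subst hi; simp [h2, h3]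
    · simpa [hi] using h1 i
  have h2 : volume (openBox (Function.update α j s) (Function.update β j t)) =
      ENNReal.ofReal (t - s) * ∏ i ∈ Finset.univ.erase j, ENNReal.ofReal (β i - α i) := by
    rw [volume_openBox, ← Finset.mul_prod_erase _ _ (Finset.mem_univ j)]
    simp only [Function.update_self]
    congr 1
    refine Finset.prod_congr rfl fun i hi => ?_
    rw [Function.update_of_ne (Finset.ne_of_mem_erase hi),
      Function.update_of_ne (Finset.ne_of_mem_erase hi)]
  calc volume S * ENNReal.ofReal (β j - α j)
      ≤ (ENNReal.ofReal (t - s) * ∏ i ∈ Finset.univ.erase j, ENNReal.ofReal (β i - α i)) *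
          ENNReal.ofReal (β j - α j) := by rw [← h2]; gcongr
    _ = volume (openBox α β) * ENNReal.ofReal (t - s) := by
        rw [volume_openBox, ← Finset.mul_prod_erase _ _ (Finset.mem_univ j)]; ring

lemma isOpen_unitCube : IsOpen (unitCube N) := isOpen_openBox _ _

lemma volume_unitCube : volume (unitCube N) = 1 := by
  rw [unitCube_eq_openBox, volume_openBox]; simp

lemma unitCube_nonempty : (unitCube N).Nonempty :=
  nonempty_of_measure_ne_zero (μ := volume) (by rw [volume_unitCube]; exact one_ne_zero)

lemma unitCube_ne_univ (hN : 1 ≤ N) : unitCube N ≠ univ := by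
  intro h
  have h1 : (0 : Euc N) ∈ unitCube N := h ▸ mem_univ _
  exact lt_irrefl _ (h1 ⟨0, hN⟩).1

end box

/-! ### The quasiconvexity inequality of `ZEnv W` for piecewise affine functions. -/

section affqc
variable {m N : ℕ}

/-- The quasiconvexity inequality for piecewise affine functions. -/
def AffQC (f : Mat m N → ℝ≥0∞) : Prop :=
  ∀ (ξ : Mat m N) (D : Set (Euc N)), IsOpen D → D.Nonempty → Bornology.IsBounded D →
    volume (frontier D) = 0 → ∀ (ι : Type) [Fintype ι] (V : ι → Set (Euc N)) (A : ι → Mat m N)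
      (φ : Euc N → Euc m), PWA D V A φ → f ξ * volume D ≤ ∑ i, volume (V i) * f (ξ + A i)

lemma zEnv_le_sum {ι : Type} [Fintype ι] {V : ι → Set (Euc N)} {A : ι → Mat m N}
    {φ : Euc N → Euc m} (h : PWA (unitCube N) V A φ) (f : Mat m N → ℝ≥0∞) (ξ : Mat m N) :
    ZEnv f ξ ≤ ∑ i, volume (V i) * f (ξ + A i) := by
  rw [← h.lintegral (fun B => f (ξ + B))]
  exact iInf₂_le φ (h.isAffZero isOpen_unitCube)

lemma exists_pwa_zEnv (hN : 1 ≤ N) (f : Mat m N → ℝ≥0∞) (ξ : Mat m N) {c : ℝ≥0∞}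
    (hc : ZEnv f ξ < c) : ∃ (k : ℕ) (V : Fin k → Set (Euc N)) (A : Fin k → Mat m N)
      (φ : Euc N → Euc m), PWA (unitCube N) V A φ ∧ ∑ i, volume (V i) * f (ξ + A i) < c := by
  simp only [ZEnv, iInf_lt_iff] at hc
  obtain ⟨φ, hφ, hlt⟩ := hc
  obtain ⟨k, V, A, h⟩ := hφ.exists_pwa (unitCube_ne_univ hN) isOpen_unitCube
  refine ⟨k, V, A, _, h, ?_⟩
  rw [← h.lintegral (fun B => f (ξ + B))]
  refine lt_of_le_of_lt (le_of_eq ?_) hlt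
  refine setLIntegral_congr_fun isOpen_unitCube.measurableSet fun x hx => ?_
  have : (unitCube N).indicator φ =ᶠ[𝓝 x] φ := by
    filter_upwards [isOpen_unitCube.mem_nhds hx] with y hy
    simp [hy]
  simp only [this.fderiv_eq]

lemma pwa_zero {D : Set (Euc N)} (hD : IsOpen D) :
    PWA D (fun _ : Unit => D) (fun _ => (0 : Mat m N)) (fun _ => 0) :=
  ⟨⟨0, LipschitzWith.const 0⟩, fun _ _ => rfl, fun _ => hD, fun _ => Subset.rfl,
    fun i j h => (h rfl).elim, by simp [iUnion_const], fun _ x _ => hasFDerivAt_const 0 x⟩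

lemma zEnv_le (f : Mat m N → ℝ≥0∞) : ZEnv f ≤ f := by
  intro ξ
  refine (zEnv_le_sum (pwa_zero isOpen_unitCube) f ξ).trans ?_
  simp [volume_unitCube]

/-- Two fillings: cubes with almost optimal functions inside the pieces of `φ`, then copies of `D`
inside the cube. The second one turns a function on `D` into a competitor for `ZEnv W ξ`. Finiteness
of `ZEnv W` makes the choice of almost optimal functions possible. -/
theorem affQC_zEnv (hN : 1 ≤ N) (W : Mat m N → ℝ≥0∞) (hZ : ∀ ξ, ZEnv W ξ < ⊤) :
    AffQC (ZEnv W) := by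
  intro ξ D hDo hDne hDb hDf ι _ V A φ h
  have hDt : volume D ≠ ⊤ := hDb.measure_lt_top.ne
  refine ENNReal.le_of_forall_pos_le_add fun ε hε _ => ?_
  obtain ⟨δ, hδ, hδε⟩ : ∃ δ : ℝ≥0∞, 0 < δ ∧ volume D * δ ≤ ε := by
    have hD0 : volume D ≠ 0 := (hDo.measure_pos volume hDne).ne'
    exact ⟨ε / volume D, ENNReal.div_pos (by exact_mod_cast hε.ne') hDt,
      (ENNReal.mul_div_cancel hD0 hDt).le⟩
  choose k U B ψ hψ hlt using fun i => exists_pwa_zEnv hN W (ξ + A i)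
    (ENNReal.lt_add_right (hZ (ξ + A i)).ne hδ.ne')
  obtain ⟨V', φ', h', hV'⟩ := h.refine isOpen_unitCube unitCube_nonempty
    (isBounded_openBox _ _) (volume_frontier_openBox _ _) hψ
  -- The function being refined here is zero, with the whole cube as its only piece.
  obtain ⟨V'', φ'', h'', hV''⟩ := (pwa_zero (m := m) (isOpen_unitCube (N := N))).refine
    hDo hDne hDb hDf (κ := fun _ => Σ i, Fin (k i)) (fun _ => h')
  have h1 := zEnv_le_sum h'' W ξ
  calc ZEnv W ξ * volume D
      ≤ (∑ s, volume (V'' s) * W (ξ + (0 + (A s.2.1 + B s.2.1 s.2.2)))) * volume D := by gcongr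
    _ = ∑ s : Σ _ : Unit, Σ i, Fin (k i), volume (V' s.2) * W (ξ + A s.2.1 + B s.2.1 s.2.2) := by
        rw [Finset.sum_mul]
        refine Finset.sum_congr rfl fun s _ => ?_
        have := hV'' s
        rw [volume_unitCube, one_mul] at this
        rw [mul_right_comm, this, zero_add, add_assoc]
    _ = ∑ i, ∑ j, volume (V' ⟨i, j⟩) * W (ξ + A i + B i j) := by
        rw [Fintype.sum_sigma, Fintype.sum_unique, Fintype.sum_sigma]
    _ = ∑ i, volume (V i) * ∑ j, volume (U i j) * W (ξ + A i + B i j) := by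
        refine Finset.sum_congr rfl fun i _ => ?_
        rw [Finset.mul_sum]
        refine Finset.sum_congr rfl fun j _ => ?_
        have := hV' ⟨i, j⟩
        rw [volume_unitCube, mul_one] at this
        rw [this, mul_assoc]
    _ ≤ ∑ i, volume (V i) * (ZEnv W (ξ + A i) + δ) := by
        gcongr with i; exact (hlt i).le
    _ = ∑ i, volume (V i) * ZEnv W (ξ + A i) + volume D * δ := by
        simp only [mul_add, Finset.sum_add_distrib, ← Finset.sum_mul, h.sum_measure]
    _ ≤ _ := by gcongr

end affqc

/-! ### Tents over boxes and convexity along `a ⊗ e_j`. -/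

/-- The rank-one matrix `a ⊗ e_j`. -/
noncomputable def rankOne {m N : ℕ} (a : Euc m) (j : Fin N) : Mat m N :=
  (EuclideanSpace.proj j : Euc N →L[ℝ] ℝ).smulRight a

section levels
variable {N : ℕ}

lemma volume_level_eq_zero (L : Euc N →L[ℝ] ℝ) (hL : L ≠ 0) (c : ℝ) :
    volume {x | L x = c} = 0 := by
  by_cases h : ∃ x₀, L x₀ = c
  · obtain ⟨x₀, hx₀⟩ := h
    have h1 : {x | L x = c} = (fun x => x + (-x₀)) ⁻¹' (LinearMap.ker (L : Euc N →ₗ[ℝ] ℝ) : Set _) := by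
      ext x
      simp [← hx₀, sub_eq_zero, ← sub_eq_add_neg]
    rw [h1, measure_preimage_add_right]
    refine Measure.addHaar_submodule _ _ fun h2 => hL ?_
    ext x
    have : x ∈ LinearMap.ker (L : Euc N →ₗ[ℝ] ℝ) := h2 ▸ Submodule.mem_top
    simpa using this
  · push Not at h
    rw [show {x | L x = c} = ∅ from eq_empty_of_forall_notMem fun x hx => h x hx]
    simp

end levels

section tent
variable {m N : ℕ}

/-- The truncated minimum of finitely many affine functions of one coordinate each is piecewise
affine on its positivity set. -/
lemma pwa_tent [NeZero N] (a : Euc m) (k : Fin N × Bool → ℝ) (c : Fin N → ℝ)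
    (hk0 : ∀ q, k q ≠ 0) (hk : ∀ j, k (j, true) ≠ k (j, false))
    (ℓ : Fin N × Bool → Euc N → ℝ) (hℓ : ∀ q x, ℓ q x = c q.1 + k q * x q.1) :
    PWA {x | ∀ q, 0 < ℓ q x}
      (fun q => {x | (∀ q, 0 < ℓ q x) ∧ ∀ q', q' ≠ q → ℓ q x < ℓ q' x})
      (fun q => k q • rankOne a q.1)
      (fun x => max 0 (Finset.univ.inf' Finset.univ_nonempty fun q => ℓ q x) • a) := by
  have hcont : ∀ q, Continuous (ℓ q) := fun q => by
    simp only [funext (hℓ q)]; fun_prop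
  have hle : ∀ q x, (Finset.univ.inf' Finset.univ_nonempty fun q => ℓ q x) ≤ ℓ q x :=
    fun q x => Finset.inf'_le _ (Finset.mem_univ q)
  have hex : ∀ x, ∃ q, (Finset.univ.inf' Finset.univ_nonempty fun q => ℓ q x) = ℓ q x := fun x => by
    obtain ⟨q, -, hq⟩ := Finset.exists_mem_eq_inf' (Finset.univ_nonempty) fun q => ℓ q x
    exact ⟨q, hq⟩
  have hVo : ∀ q, IsOpen {x | (∀ q, 0 < ℓ q x) ∧ ∀ q', q' ≠ q → ℓ q x < ℓ q' x} := by
    intro q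
    have h1 : IsOpen {x | ∀ q, 0 < ℓ q x} := by
      rw [ofPred_forall]
      exact isOpen_iInter_of_finite fun q => isOpen_lt continuous_const (hcont q)
    have h2 : IsOpen {x | ∀ q', q' ≠ q → ℓ q x < ℓ q' x} := by
      simp only [ofPred_forall]
      exact isOpen_iInter_of_finite fun q' => isOpen_iInter_of_finite fun _ =>
        isOpen_lt (hcont q) (hcont q')
    exact h1.inter h2
  refine ⟨?_, ?_, hVo, ?_, ?_, ?_, ?_⟩
  · have h1 : LipschitzWith (∑ q, ‖k q‖₊)
        (fun x => Finset.univ.inf' Finset.univ_nonempty fun q => ℓ q x) := by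
      refine LipschitzWith.of_le_add_mul _ fun x y => ?_
      obtain ⟨q, hq⟩ := hex y
      rw [hq]
      refine (hle q x).trans ?_
      have h2 : |x q.1 - y q.1| ≤ dist x y := by
        rw [dist_eq_norm]; exact PiLp.norm_apply_le (x - y) q.1
      have h3 : |k q| ≤ ∑ q, |k q| :=
        Finset.single_le_sum (f := fun q => |k q|) (fun _ _ => abs_nonneg _) (Finset.mem_univ q)
      have h4 : k q * (x q.1 - y q.1) ≤ (∑ q, |k q|) * dist x y :=
        (le_abs_self _).trans (by rw [abs_mul]; gcongr)
      rw [hℓ, hℓ]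
      push_cast
      simp only [Real.norm_eq_abs]
      linarith
    exact ⟨_, (ContinuousLinearMap.toSpanSingleton ℝ a).lipschitz.comp (h1.const_max 0)⟩
  · intro x hx
    simp only [mem_ofPred_eq, not_forall, not_lt] at hx
    obtain ⟨q, hq⟩ := hx
    rw [max_eq_left ((hle q x).trans hq), zero_smul]
  · exact fun q x hx => hx.1
  · intro q q' hqq
    refine Set.disjoint_left.2 fun x hx hx' => ?_
    exact lt_asymm (hx.2 q' hqq.symm) (hx'.2 q hqq)
  · have hsub : ({x | ∀ q, 0 < ℓ q x} \
        ⋃ q, {x | (∀ q, 0 < ℓ q x) ∧ ∀ q', q' ≠ q → ℓ q x < ℓ q' x}) ⊆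
        ⋃ r : {r : (Fin N × Bool) × (Fin N × Bool) // r.2 ≠ r.1}, {x | ℓ r.1.1 x = ℓ r.1.2 x} := by
      rintro x ⟨hx, hx'⟩
      obtain ⟨q, hq⟩ := hex x
      simp only [mem_iUnion, mem_ofPred_eq, not_exists, not_and, not_forall, not_lt] at hx'
      obtain ⟨q', hne, hq'⟩ := hx' q hx
      exact mem_iUnion.2 ⟨⟨(q, q'), hne⟩, le_antisymm (hq ▸ hle q' x) hq'⟩
    refine measure_mono_null hsub (measure_iUnion_null ?_)
    rintro ⟨⟨q, q'⟩, hne⟩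
    have h1 : {x | ℓ q x = ℓ q' x} =
        {x | (k q • EuclideanSpace.proj q.1 - k q' • EuclideanSpace.proj q'.1 : Euc N →L[ℝ] ℝ) x
          = c q'.1 - c q.1} := by
      ext x
      simp only [mem_ofPred_eq, hℓ, sub_apply, smul_apply,
        PiLp.proj_apply, smul_eq_mul]
      constructor <;> intro h <;> linarith
    change volume {x | ℓ q x = ℓ q' x} = 0
    rw [h1]
    refine volume_level_eq_zero _ (fun h => ?_) _
    have h2 := DFunLike.congr_fun h (EuclideanSpace.single q.1 (1 : ℝ))
    simp only [sub_apply, smul_apply,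
      PiLp.proj_apply, smul_eq_mul, PiLp.single_apply,
      zero_apply] at h2
    obtain ⟨j, s⟩ := q
    obtain ⟨j', s'⟩ := q'
    by_cases hj : j' = j
    · subst hj
      simp only [if_true, mul_one] at h2
      cases s <;> cases s'
      · exact hne rfl
      · exact hk j' (by linarith)
      · exact hk j' (by linarith)
      · exact hne rfl
    · simp [hj, hk0] at h2
  · intro q x hx
    have h1 : HasFDerivAt (fun y => ℓ q y • a) (k q • rankOne a q.1) x := by
      have h2 : HasFDerivAt (ℓ q) (k q • EuclideanSpace.proj q.1 : Euc N →L[ℝ] ℝ) x := by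
        simp only [funext (hℓ q)]
        exact (((EuclideanSpace.proj q.1 : Euc N →L[ℝ] ℝ).hasFDerivAt).const_mul (k q)).const_add _
      have h3 := h2.smul_const a
      have h4 : (k q • EuclideanSpace.proj q.1 : Euc N →L[ℝ] ℝ).smulRight a =
          k q • rankOne a q.1 := by
        ext y i; simp [rankOne, mul_assoc]
      rwa [h4] at h3
    refine h1.congr_of_eventuallyEq ?_
    filter_upwards [(hVo q).mem_nhds hx] with y hy
    have h5 : (Finset.univ.inf' Finset.univ_nonempty fun q => ℓ q y) = ℓ q y := by
      refine le_antisymm (hle q y) (Finset.le_inf' _ _ fun q' _ => ?_)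
      by_cases h : q' = q
      · rw [h]
      · exact (hy.2 q' h).le
    rw [h5, max_eq_right (hy.1 q).le]

lemma volume_le_of_slab {α β : Fin N → ℝ} {j : Fin N} {s t θ : ℝ} {S : Set (Euc N)}
    (hαβ : α j < β j) (hθ : t - s ≤ θ * (β j - α j)) (hθ0 : 0 ≤ θ)
    (hS : ∀ x ∈ S, x ∈ openBox α β ∧ s < x j ∧ x j < t) :
    volume S ≤ volume (openBox α β) * ENNReal.ofReal θ := by
  have h1 := volume_openBox_slab α β hS
  have h0 : ENNReal.ofReal (β j - α j) ≠ 0 := by simpa using hαβ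
  rw [← ENNReal.mul_le_mul_iff_left h0 ENNReal.ofReal_ne_top]
  refine h1.trans ?_
  rw [mul_assoc, ← ENNReal.ofReal_mul hθ0]
  gcongr

/-- The tent is the minimum of `1 - s x_{j₀}`, `1 + t x_{j₀}` and `L ± x_j` for `j ≠ j₀`, over the
box where all are positive. In direction `j₀` the box is `(-1/t, 1/s)`, cut by the ridge `x_{j₀} =
0` in proportion `s : t`. The lateral faces are active only within distance `1` of the sides, a
fraction `1 / (2L)` of the box each. Upper bounds for the volumes of the pieces suffice. -/
lemma AffQC.le_tent_sum [NeZero N] {f : Mat m N → ℝ≥0∞} (hf : AffQC f) (ξ : Mat m N) (a : Euc m)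
    (j₀ : Fin N) {s t : ℝ} (hs : 0 < s) (ht : 0 < t) (hst : s + t = 1) {L : ℝ} (hL : 1 ≤ L)
    (k θ : Fin N × Bool → ℝ)
    (hk : k = fun q => if q.1 = j₀ then (if q.2 then -s else t) else (if q.2 then -1 else 1))
    (hθ : θ = fun q => if q.1 = j₀ then (if q.2 then t else s) else 1 / (2 * L)) :
    f ξ ≤ ∑ q : Fin N × Bool, ENNReal.ofReal (θ q) * f (ξ + k q • rankOne a q.1) := by
  set c : Fin N → ℝ := fun j => if j = j₀ then 1 else L with hc
  set α : Fin N → ℝ := fun j => if j = j₀ then -(1 / t) else -L with hα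
  set β : Fin N → ℝ := fun j => if j = j₀ then 1 / s else L with hβ
  have hP := pwa_tent a k c (by
      rintro ⟨j, b⟩
      by_cases hj : j = j₀ <;> cases b <;> simp [hk, hj, hs.ne', ht.ne'])
    (by
      intro j
      by_cases hj : j = j₀
      · simp only [hk, hj, if_true, Bool.false_eq_true, if_false]; linarith
      · simp only [hk, hj, if_true, Bool.false_eq_true, if_false]; norm_num) _ (fun q x => rfl)
  have hαβ : ∀ j, α j < β j := by
    intro j
    by_cases hj : j = j₀
    · have h1 : 0 < 1 / t := by positivity
      have h2 : 0 < 1 / s := by positivity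
      simp only [hα, hβ, hj, if_true]; linarith
    · simp only [hα, hβ, hj, if_false]; linarith
  have hD : {x : Euc N | ∀ q, 0 < c q.1 + k q * x q.1} = openBox α β := by
    ext x
    have hj : ∀ j, (0 < c j + k (j, true) * x j ∧ 0 < c j + k (j, false) * x j) ↔
        (α j < x j ∧ x j < β j) := by
      intro j
      by_cases hj : j = j₀
      · simp only [hk, hα, hβ, hc, hj, if_true, Bool.false_eq_true, if_false]
        rw [neg_lt, lt_div_iff₀' ht, lt_div_iff₀' hs]
        constructor <;> rintro ⟨h1, h2⟩ <;> constructor <;> linarith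
      · simp only [hk, hα, hβ, hc, hj, if_true, Bool.false_eq_true, if_false]
        constructor <;> rintro ⟨h1, h2⟩ <;> constructor <;> linarith
    constructor
    · intro h j; exact (hj j).1 ⟨h (j, true), h (j, false)⟩
    · rintro h ⟨j, b⟩
      have := (hj j).2 (h j)
      cases b
      · exact this.2
      · exact this.1
  rw [hD] at hP
  have hvol0 : volume (openBox α β) ≠ 0 := by
    rw [volume_openBox, Finset.prod_ne_zero_iff]
    intro j _
    simpa using hαβ j
  have hvolt : volume (openBox α β) ≠ ⊤ := (isBounded_openBox α β).measure_lt_top.ne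
  have h1 := hf ξ _ (isOpen_openBox α β) (nonempty_of_measure_ne_zero hvol0)
    (isBounded_openBox α β) (volume_frontier_openBox α β) _ _ _ _ hP
  rw [← ENNReal.mul_le_mul_iff_left hvol0 hvolt]
  refine h1.trans ?_
  rw [Finset.sum_mul]
  refine Finset.sum_le_sum fun q _ => ?_
  rw [mul_right_comm]
  gcongr
  rw [mul_comm]
  obtain ⟨j, b⟩ := q
  have hmem : ∀ x : Euc N, (∀ q, 0 < c q.1 + k q * x q.1) → x ∈ openBox α β := fun x hx =>
    hD ▸ hx
  by_cases hj : j = j₀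
  · subst hj
    have e1 : β j - α j = 1 / s + 1 / t := by simp [hα, hβ]
    cases b
    · refine volume_le_of_slab (j := j) (s := α j) (t := 0) (hαβ j) ?_ ?_ ?_
      · rw [e1]; simp only [hθ, hα, if_true, Bool.false_eq_true, if_false]
        field_simp; linarith
      · simp [hθ, hs.le]
      · rintro x ⟨hx, hx'⟩
        have hb := hmem x hx
        refine ⟨hb, (hb j).1, ?_⟩
        have h2 := hx' (j, true) (by simp)
        simp only [hk, hc, if_true, Bool.false_eq_true, if_false] at h2
        have h3 : (s + t) * x j < 0 := by linarith
        rw [hst] at h3; linarith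
    · refine volume_le_of_slab (j := j) (s := 0) (t := β j) (hαβ j) ?_ ?_ ?_
      · rw [e1]; simp only [hθ, hβ, if_true]
        field_simp; linarith
      · simp [hθ, ht.le]
      · rintro x ⟨hx, hx'⟩
        have hb := hmem x hx
        refine ⟨hb, ?_, (hb j).2⟩
        have h2 := hx' (j, false) (by simp)
        simp only [hk, hc, if_true, Bool.false_eq_true, if_false] at h2
        have h3 : 0 < (s + t) * x j := by linarith
        rw [hst] at h3; linarith
  · have e1 : β j - α j = 2 * L := by simp only [hα, hβ, hj, if_false]; ring
    have e2 : (1 : ℝ) ≤ 1 / (2 * L) * (2 * L) := by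
      rw [div_mul_cancel₀]; positivity
    -- The ridge has height `1`, so a lateral face can be active only where `L - |x_j| < 1`.
    have hmin : ∀ x : Euc N, (c j₀ + k (j₀, true) * x j₀ ≤ 1) ∨ (c j₀ + k (j₀, false) * x j₀ ≤ 1) := by
      intro x
      simp only [hk, hc, if_true, Bool.false_eq_true, if_false]
      rcases le_total 0 (x j₀) with h | h
      · left; nlinarith
      · right; nlinarith
    cases b
    · refine volume_le_of_slab (j := j) (s := α j) (t := 1 - L) (hαβ j) ?_ ?_ ?_
      · rw [e1]; simp only [hθ, hα, hj, if_false]; linarith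
      · simp only [hθ, hj, if_false]; positivity
      · rintro x ⟨hx, hx'⟩
        have hb := hmem x hx
        refine ⟨hb, (hb j).1, ?_⟩
        have h2 := hx' (j₀, true) (by simp [Ne.symm hj])
        have h3 := hx' (j₀, false) (by simp [Ne.symm hj])
        have h4 : c j + k (j, false) * x j = L + x j := by simp [hk, hc, hj]
        rcases hmin x with h | h <;> linarith
    · refine volume_le_of_slab (j := j) (s := L - 1) (t := β j) (hαβ j) ?_ ?_ ?_
      · rw [e1]; simp only [hθ, hβ, hj, if_false]; linarith
      · simp only [hθ, hj, if_false]; positivity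
      · rintro x ⟨hx, hx'⟩
        have hb := hmem x hx
        refine ⟨hb, ?_, (hb j).2⟩
        have h2 := hx' (j₀, true) (by simp [Ne.symm hj])
        have h3 := hx' (j₀, false) (by simp [Ne.symm hj])
        have h4 : c j + k (j, true) * x j = L - x j := by simp [hk, hc, hj]; ring
        rcases hmin x with h | h <;> linarith

/-- The tent inequality at `η + s a ⊗ e_{j₀}`: the slopes `-s` and `t` lead to `η` and `η + a ⊗
e_{j₀}`. As `L → ∞` the lateral terms vanish, because `f` is finite. -/
theorem AffQC.convex_rankOne {f : Mat m N → ℝ≥0∞} (hf : AffQC f)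
    (hfin : ∀ ξ, f ξ < ⊤) (η : Mat m N) (a : Euc m) (j₀ : Fin N) {s t : ℝ} (hs : 0 ≤ s)
    (ht : 0 ≤ t) (hst : s + t = 1) :
    f (η + s • rankOne a j₀) ≤
      ENNReal.ofReal t * f η + ENNReal.ofReal s * f (η + rankOne a j₀) := by
  have : NeZero N := ⟨fun h => by subst h; exact j₀.elim0⟩
  rcases hs.eq_or_lt with rfl | hs
  · rw [zero_smul ℝ (rankOne a j₀), show t = 1 by linarith]; simp
  rcases ht.eq_or_lt with rfl | ht
  · rw [show s = 1 by linarith, one_smul ℝ (rankOne a j₀)]; simp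
  set k : Fin N × Bool → ℝ := fun q =>
    if q.1 = j₀ then (if q.2 then -s else t) else (if q.2 then -1 else 1) with hk
  let θ : ℕ → Fin N × Bool → ℝ := fun n q =>
    if q.1 = j₀ then (if q.2 then t else s) else 1 / (2 * ((n : ℝ) + 1))
  let θ' : Fin N × Bool → ℝ := fun q => if q.1 = j₀ then (if q.2 then t else s) else 0
  have hlim : ∀ q, Tendsto (fun n => θ n q) atTop (𝓝 (θ' q)) := by
    intro q
    by_cases hq : q.1 = j₀
    · simp only [θ, θ', hq, if_true]; exact tendsto_const_nhds
    · simp only [θ, θ', hq, if_false]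
      have := (tendsto_one_div_add_atTop_nhds_zero_nat (𝕜 := ℝ)).const_mul (1 / 2)
      rw [mul_zero] at this
      refine this.congr fun n => ?_
      field_simp
  have h1 : f (η + s • rankOne a j₀) ≤ ∑ q : Fin N × Bool,
      ENNReal.ofReal (θ' q) * f (η + s • rankOne a j₀ + k q • rankOne a q.1) := by
    refine ge_of_tendsto' (tendsto_finsetSum _ fun q _ =>
      ENNReal.Tendsto.mul_const (ENNReal.tendsto_ofReal (hlim q)) (Or.inr (hfin _).ne)) fun n => ?_
    exact hf.le_tent_sum _ a j₀ hs ht hst (by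
      have : (0 : ℝ) ≤ n := n.cast_nonneg
      linarith) k _ hk rfl
  refine h1.trans (le_of_eq ?_)
  rw [Fintype.sum_prod_type, Finset.sum_eq_single j₀]
  · simp only [Fintype.sum_bool, θ', hk, if_true, Bool.false_eq_true, if_false]
    rw [neg_smul s (rankOne a j₀), add_neg_cancel_right, add_assoc, ← add_smul s t (rankOne a j₀),
      hst, one_smul ℝ (rankOne a j₀)]
  · intro j _ hj
    simp [θ', hj]
  · simp

end tent

/-! ### Nonnegative separately convex functions are continuous. -/

section sepconvex
variable {ι : Type*} [Fintype ι] [DecidableEq ι] {g : (ι → ℝ) → ℝ}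

/-- `t` is a convex combination of `s` and `s ± 1` in which the latter has weight `|t - s|`. -/
lemma ConvexOn.le_add_abs_mul {p : ℝ → ℝ} (hp : ConvexOn ℝ univ p) {s t M : ℝ}
    (h0 : 0 ≤ p s) (h1 : p (s + 1) ≤ M) (h2 : p (s - 1) ≤ M) (hst : |t - s| ≤ 1) :
    p t ≤ p s + |t - s| * M := by
  have key : ∀ u, p u ≤ M → t = (1 - |t - s|) * s + |t - s| * u → p t ≤ p s + |t - s| * M := by
    intro u hu ht
    have h3 := hp.2 (mem_univ s) (mem_univ u) (sub_nonneg.2 hst) (abs_nonneg (t - s)) (by ring)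
    simp only [smul_eq_mul] at h3
    rw [← ht] at h3
    have h4 : 0 ≤ |t - s| * p s := by positivity
    have h5 : |t - s| * p u ≤ |t - s| * M := by gcongr
    linarith
  rcases le_total s t with h | h
  · refine key _ h1 ?_
    rw [abs_of_nonneg (sub_nonneg.2 h)]; ring
  · refine key _ h2 ?_
    rw [abs_of_nonpos (sub_nonpos.2 h)]; ring

/-- Convexity in one variable moves that coordinate to an endpoint without decreasing the larger of
the two values. Doing so for each coordinate leads to the corners of the box, and the sum of the
corner values dominates each of them. The set `S` contains the coordinates still free. -/
lemma exists_bound_of_convexOn_update (h0 : ∀ x, 0 ≤ g x)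
    (hc : ∀ x i, ConvexOn ℝ univ fun t => g (Function.update x i t)) (x : ι → ℝ) (r : ℝ) :
    ∃ M, ∀ y, (∀ i, |y i - x i| ≤ r) → g y ≤ M := by
  let P : Finset (ι → ℝ) := Fintype.piFinset fun i => {x i - r, x i + r}
  refine ⟨∑ v ∈ P, g v, ?_⟩
  suffices h : ∀ S : Finset ι, ∀ y, (∀ i, |y i - x i| ≤ r) →
      (∀ i, i ∉ S → y i = x i - r ∨ y i = x i + r) → g y ≤ ∑ v ∈ P, g v from
    fun y hy => h Finset.univ y hy fun i hi => absurd (Finset.mem_univ i) hi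
  intro S
  induction S using Finset.induction_on with
  | empty =>
    intro y _ hy
    refine Finset.single_le_sum (f := g) (fun v _ => h0 v) ?_
    simp only [P, Fintype.mem_piFinset, Finset.mem_insert, Finset.mem_singleton]
    exact fun i => hy i (Finset.notMem_empty i)
  | insert i S hi ih =>
    intro y hy hyS
    have hr : 0 ≤ r := (abs_nonneg _).trans (hy i)
    have hend : ∀ e, (e = x i - r ∨ e = x i + r) → g (Function.update y i e) ≤ ∑ v ∈ P, g v := by
      intro e he
      refine ih _ (fun k => ?_) fun k hk => ?_
      · by_cases hki : k = i
        · subst hki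
          rw [Function.update_self]
          rcases he with rfl | rfl <;> simp [abs_of_nonneg hr]
        · rw [Function.update_of_ne hki]; exact hy k
      · by_cases hki : k = i
        · subst hki
          rwa [Function.update_self]
        · rw [Function.update_of_ne hki]
          exact hyS k (by simp [hki, hk])
    have h1 := (hc y i).le_max_of_mem_Icc (x := x i - r) (y := x i + r) (z := y i)
      (mem_univ _) (mem_univ _) (by
        have := abs_le.1 (hy i)
        constructor <;> linarith)
    simp only [Function.update_eq_self] at h1
    exact h1.trans (max_le (hend _ (Or.inl rfl)) (hend _ (Or.inr rfl)))

theorem continuous_of_convexOn_update (h0 : ∀ x, 0 ≤ g x)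
    (hc : ∀ x i, ConvexOn ℝ univ fun t => g (Function.update x i t)) : Continuous g := by
  refine continuous_iff_continuousAt.2 fun x => ?_
  -- Radius `2` leaves room for the points `y i ± 1` with `y` in the box of radius `1`.
  obtain ⟨M, hM⟩ := exists_bound_of_convexOn_update h0 hc x 2
  -- Passing from `y` to `z` one coordinate at a time costs at most `|z i - y i| * M` at each
  -- change. The roles of `x` and `z` are exchanged later to obtain a two-sided bound.
  have key : ∀ S : Finset ι, ∀ y z : ι → ℝ, (∀ i, |y i - x i| ≤ 1) → (∀ i, |z i - x i| ≤ 1) →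
      (∀ i, |z i - y i| ≤ 1) → (∀ i, i ∉ S → z i = y i) →
      g z ≤ g y + ∑ i ∈ S, |z i - y i| * M := by
    intro S
    induction S using Finset.induction_on with
    | empty =>
      intro y z _ _ _ h
      rw [show z = y from funext fun i => h i (Finset.notMem_empty i)]; simp
    | insert i S hi ih =>
      intro y z hy hz hyz h
      have hbox : ∀ e, |e - x i| ≤ 2 → g (Function.update z i e) ≤ M := by
        intro e he
        refine hM _ fun k => ?_
        by_cases hki : k = i
        · subst hki; rwa [Function.update_self]
        · rw [Function.update_of_ne hki]; linarith [hz k]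
      have h1 := (hc z i).le_add_abs_mul (s := y i) (t := z i) (M := M) (h0 _)
        (hbox _ (by have := abs_le.1 (hy i); rw [abs_le]; constructor <;> linarith))
        (hbox _ (by have := abs_le.1 (hy i); rw [abs_le]; constructor <;> linarith)) (hyz i)
      simp only [Function.update_eq_self] at h1
      have h2 := ih y (Function.update z i (y i)) hy
        (fun k => by
          by_cases hki : k = i
          · subst hki; rw [Function.update_self]; exact hy k
          · rw [Function.update_of_ne hki]; exact hz k)
        (fun k => by
          by_cases hki : k = i
          · subst hki; rw [Function.update_self]; simp
          · rw [Function.update_of_ne hki]; exact hyz k)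
        (fun k hk => by
          by_cases hki : k = i
          · subst hki; rw [Function.update_self]
          · rw [Function.update_of_ne hki]; exact h k (by simp [hki, hk]))
      have h3 : ∑ k ∈ S, |Function.update z i (y i) k - y k| * M = ∑ k ∈ S, |z k - y k| * M :=
        Finset.sum_congr rfl fun k hk => by
          rw [Function.update_of_ne (ne_of_mem_of_not_mem hk hi)]
      rw [Finset.sum_insert hi]
      linarith
  have hlim : Tendsto (fun z : ι → ℝ => ∑ i, |z i - x i| * M) (𝓝 x) (𝓝 0) := by
    have : Continuous fun z : ι → ℝ => ∑ i, |z i - x i| * M := by fun_prop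
    simpa using this.tendsto x
  rw [ContinuousAt, tendsto_iff_dist_tendsto_zero]
  refine squeeze_zero' (Eventually.of_forall fun _ => dist_nonneg) ?_ hlim
  filter_upwards [Metric.closedBall_mem_nhds x one_pos] with z hz
  have hz' : ∀ i, |z i - x i| ≤ 1 := fun i => (dist_le_pi_dist z x i).trans hz
  have h1 := key Finset.univ x z (fun i => by simp) hz' hz' (by simp)
  have h2 := key Finset.univ z x hz' (fun i => by simp) (fun i => by rw [abs_sub_comm]; exact hz' i)
    (by simp)
  simp only [abs_sub_comm (x _)] at h2
  rw [Real.dist_eq, abs_le]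
  constructor <;> linarith

end sepconvex

/-! ### Matrix entries as coordinates, and continuity. -/

section mat
variable {m N : ℕ}

lemma rankOne_apply (a : Euc m) (j : Fin N) (x : Euc N) : rankOne a j x = x j • a := rfl

lemma rankOne_smul (c : ℝ) (a : Euc m) (j : Fin N) : rankOne (c • a) j = c • rankOne a j := by
  ext x i
  simp [rankOne_apply]
  ring

lemma rankOne_sum_eq (ξ : Mat m N) :
    ∑ q : Fin m × Fin N, (ξ (EuclideanSpace.single q.2 1) q.1) •
      rankOne (EuclideanSpace.single q.1 (1 : ℝ)) q.2 = ξ := by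
  ext x i
  have hx : x = ∑ j, x j • EuclideanSpace.single j (1 : ℝ) := by
    ext k; simp [Pi.single_apply]
  conv_rhs => rw [hx]
  simp only [map_sum, map_smul, Fintype.sum_prod_type, sum_apply,
    smul_apply, rankOne_apply, WithLp.ofLp_sum, Finset.sum_apply,
    WithLp.ofLp_smul, Pi.smul_apply, smul_eq_mul, PiLp.single_apply]
  rw [Finset.sum_comm]
  refine Finset.sum_congr rfl fun j _ => ?_
  simp [mul_comm]

/-- The matrix units are of the form `a ⊗ e_j`, so `f` is convex in each matrix entry separately. -/
theorem AffQC.continuous {f : Mat m N → ℝ≥0∞} (hf : AffQC f) (hfin : ∀ ξ, f ξ < ⊤) :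
    Continuous f := by
  classical
  let R : Fin m × Fin N → Mat m N := fun q => rankOne (EuclideanSpace.single q.1 (1 : ℝ)) q.2
  let Ψ : (Fin m × Fin N → ℝ) → Mat m N := fun c => ∑ q, c q • R q
  let g : (Fin m × Fin N → ℝ) → ℝ := fun c => (f (Ψ c)).toReal
  have hΨ : ∀ c q t, Ψ (Function.update c q t) =
      (∑ q' ∈ Finset.univ.erase q, c q' • R q') + t • R q := by
    intro c q t
    simp only [Ψ]
    rw [← Finset.add_sum_erase _ _ (Finset.mem_univ q), Function.update_self, add_comm]
    congr 1
    exact Finset.sum_congr rfl fun q' hq' => by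
      rw [Function.update_of_ne (Finset.ne_of_mem_erase hq')]
  have hg : Continuous g := by
    refine continuous_of_convexOn_update (fun _ => ENNReal.toReal_nonneg) fun c q => ?_
    refine ⟨convex_univ, fun t₁ _ t₂ _ a b ha hb hab => ?_⟩
    simp only [g, hΨ, smul_eq_mul]
    set B := ∑ q' ∈ Finset.univ.erase q, c q' • R q'
    have h1 := hf.convex_rankOne hfin (B + t₁ • R q)
      ((t₂ - t₁) • EuclideanSpace.single q.1 (1 : ℝ)) q.2 hb ha (by linarith)
    rw [rankOne_smul] at h1
    have e1 : B + t₁ • R q + b • ((t₂ - t₁) • R q) = B + (a * t₁ + b * t₂) • R q := by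
      rw [add_assoc, smul_smul b (t₂ - t₁) (R q), ← add_smul t₁ _ (R q)]
      congr 2
      rw [show a = 1 - b by linarith]; ring
    have e2 : B + t₁ • R q + (t₂ - t₁) • R q = B + t₂ • R q := by
      rw [add_assoc, ← add_smul t₁ _ (R q)]
      congr 2
      ring
    change f (B + t₁ • R q + b • ((t₂ - t₁) • R q)) ≤ ENNReal.ofReal a * f (B + t₁ • R q) +
      ENNReal.ofReal b * f (B + t₁ • R q + (t₂ - t₁) • R q) at h1
    rw [e1, e2] at h1
    have h2 := ENNReal.toReal_mono (ENNReal.add_ne_top.2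
      ⟨ENNReal.mul_ne_top ENNReal.ofReal_ne_top (hfin _).ne,
        ENNReal.mul_ne_top ENNReal.ofReal_ne_top (hfin _).ne⟩) h1
    rwa [ENNReal.toReal_add (ENNReal.mul_ne_top ENNReal.ofReal_ne_top (hfin _).ne)
      (ENNReal.mul_ne_top ENNReal.ofReal_ne_top (hfin _).ne), ENNReal.toReal_mul,
      ENNReal.toReal_mul, ENNReal.toReal_ofReal ha, ENNReal.toReal_ofReal hb] at h2
  have h1 : f = fun ξ => ENNReal.ofReal (g fun q => ξ (EuclideanSpace.single q.2 1) q.1) := by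
    funext ξ
    simp only [g, Ψ, R]
    rw [rankOne_sum_eq, ENNReal.ofReal_toReal (hfin _).ne]
  rw [h1]
  refine ENNReal.continuous_ofReal.comp (hg.comp (continuous_pi fun q => ?_))
  exact (EuclideanSpace.proj q.1 : Euc m →L[ℝ] ℝ).continuous.comp
    (ContinuousLinearMap.apply ℝ (Euc m) (EuclideanSpace.single q.2 (1 : ℝ))).continuous

end mat

/-! ### Averages of shifted integer parts. -/

section floor

lemma integrableOn_floor (a : ℝ) : IntegrableOn (fun s : ℝ => ((⌊a + s⌋ : ℤ) : ℝ)) (Ico 0 1) := by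
  refine Measure.integrableOn_of_bounded (M := |a| + 2) (by simp) ?_ ?_
  · exact (measurable_from_top.comp (Int.measurable_floor.comp
      (measurable_const.add measurable_id))).aestronglyMeasurable
  · refine (ae_restrict_iff' measurableSet_Ico).2 (Eventually.of_forall fun s hs => ?_)
    have h1 := Int.floor_le (a + s)
    have h2 := Int.lt_floor_add_one (a + s)
    rw [Real.norm_eq_abs, abs_le]
    have h3 := neg_abs_le a
    have h4 := le_abs_self a
    constructor <;> linarith [hs.1, hs.2]

lemma floor_add_eq (a : ℝ) {s : ℝ} (hs : s ∈ Ico (0 : ℝ) 1) :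
    ⌊a + s⌋ = ⌊a⌋ + if 1 ≤ Int.fract a + s then 1 else 0 := by
  have h0 := Int.floor_add_fract a
  have h1 := Int.fract_nonneg a
  have h2 := Int.fract_lt_one a
  rw [Int.floor_eq_iff]
  split_ifs with h <;> push_cast <;> constructor <;> linarith [hs.1, hs.2]

lemma setIntegral_floor (a : ℝ) : ∫ s in Ico (0 : ℝ) 1, ((⌊a + s⌋ : ℤ) : ℝ) = a := by
  have h1 := Int.fract_nonneg a
  have h2 := Int.fract_lt_one a
  have h : ∀ s ∈ Ico (0 : ℝ) 1, ((⌊a + s⌋ : ℤ) : ℝ) =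
      (⌊a⌋ : ℝ) + (Ici (1 - Int.fract a)).indicator (fun _ => (1 : ℝ)) s := by
    intro s hs
    rw [floor_add_eq a hs]
    by_cases h : 1 ≤ Int.fract a + s
    · rw [if_pos h, indicator_of_mem (by simp only [mem_Ici]; linarith)]; push_cast; ring
    · rw [if_neg h, indicator_of_notMem (by simp only [mem_Ici]; linarith)]; push_cast; ring
  rw [setIntegral_congr_fun measurableSet_Ico h, integral_add (by simp) (by
    exact (integrable_const (1 : ℝ)).indicator measurableSet_Ici),
    integral_indicator measurableSet_Ici, Measure.restrict_restrict measurableSet_Ici]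
  have h3 : Ici (1 - Int.fract a) ∩ Ico (0 : ℝ) 1 = Ico (1 - Int.fract a) 1 := by
    ext s; simp only [mem_inter_iff, mem_Ici, mem_Ico]
    constructor
    · rintro ⟨h, h', h''⟩; exact ⟨h, h''⟩
    · rintro ⟨h, h'⟩; exact ⟨h, by linarith, h'⟩
  rw [h3]
  simp only [integral_const, MeasurableSet.univ, measureReal_restrict_apply, univ_inter, smul_eq_mul,
    mul_one, Real.volume_real_Ico]
  rw [max_eq_left (by linarith), max_eq_left (by linarith)]
  linarith [Int.floor_add_fract a]

/-- By monotonicity of the integer part the difference has a constant sign, so the absolute value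
can be taken outside the integral. -/
lemma setIntegral_abs_floor_sub (a b : ℝ) :
    ∫ s in Ico (0 : ℝ) 1, |((⌊a + s⌋ : ℤ) : ℝ) - (⌊b + s⌋ : ℤ)| = |a - b| := by
  wlog hab : b ≤ a generalizing a b
  · rw [abs_sub_comm a b, ← this b a (le_of_not_ge hab)]
    simp only [abs_sub_comm]
  have h : ∀ s ∈ Ico (0 : ℝ) 1, |((⌊a + s⌋ : ℤ) : ℝ) - (⌊b + s⌋ : ℤ)| =
      ((⌊a + s⌋ : ℤ) : ℝ) - (⌊b + s⌋ : ℤ) := by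
    intro s _
    refine abs_of_nonneg (sub_nonneg.2 ?_)
    exact_mod_cast Int.floor_le_floor (by linarith)
  rw [setIntegral_congr_fun measurableSet_Ico h, integral_sub (integrableOn_floor a)
    (integrableOn_floor b), setIntegral_floor, setIntegral_floor, abs_of_nonneg (sub_nonneg.2 hab)]

end floor

/-! ### Interpolation on Kuhn's triangulation. -/

section interp
variable {m N : ℕ}

/-- The integer point below `x + s (1, …, 1)`. -/
noncomputable def floorShift (x : Euc N) (s : ℝ) : Fin N → ℤ := fun i => ⌊x i + s⌋

/-- The Lovász extension of a function on the integer lattice; it is affine on the simplices of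
Kuhn's triangulation. -/
noncomputable def interp (w : (Fin N → ℤ) → Euc m) (x : Euc N) : Euc m :=
  ∫ s in Ico (0 : ℝ) 1, w (floorShift x s)

/-- The vertex `k + 1_S`. -/
def vertex (k : Fin N → ℤ) (S : Finset (Fin N)) : Fin N → ℤ := fun i => k i + if i ∈ S then 1 else 0

/-- The integer parts, together with the order of the fractional parts. -/
noncomputable def cell (x : Euc N) :
    (Fin N → ℤ) × (Fin N → Finset (Fin N)) × (Fin N → Finset (Fin N)) :=
  (fun i => ⌊x i⌋, fun i => {j | Int.fract (x i) ≤ Int.fract (x j)},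
    fun i => {j | Int.fract (x i) < Int.fract (x j)})

/-- The difference quotients of `w` along the edges of a simplex. -/
def edgeDiff (w : (Fin N → ℤ) → Euc m)
    (c : (Fin N → ℤ) × (Fin N → Finset (Fin N)) × (Fin N → Finset (Fin N))) (i : Fin N) : Euc m :=
  w (vertex c.1 (c.2.1 i)) - w (vertex c.1 (c.2.2 i))

/-- The gradient of `interp w` on the interior of a simplex. -/
noncomputable def cellGrad (w : (Fin N → ℤ) → Euc m)
    (c : (Fin N → ℤ) × (Fin N → Finset (Fin N)) × (Fin N → Finset (Fin N))) : Mat m N :=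
  ∑ i, rankOne (edgeDiff w c i) i

/-- `x` lies in the interior of a simplex of Kuhn's triangulation. -/
def IsGood (x : Euc N) : Prop :=
  (∀ i, 0 < Int.fract (x i)) ∧ ∀ i j, i ≠ j → Int.fract (x i) ≠ Int.fract (x j)

lemma measurable_floorShift (x : Euc N) : Measurable (floorShift x) :=
  measurable_pi_lambda _ fun _ => Int.measurable_floor.comp (measurable_const.add measurable_id)

lemma integrableOn_interp {w : (Fin N → ℤ) → Euc m} {C : ℝ} (hw : ∀ k, ‖w k‖ ≤ C) (x : Euc N) :
    IntegrableOn (fun s => w (floorShift x s)) (Ico (0 : ℝ) 1) := by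
  refine Measure.integrableOn_of_bounded (M := C) (by simp) ?_ (Eventually.of_forall fun s => hw _)
  exact ((measurable_of_countable w).comp (measurable_floorShift x)).aestronglyMeasurable

lemma norm_le_sum_abs (x : Euc N) : ‖x‖ ≤ ∑ i, |x i| := by
  have hx : x = ∑ j, x j • EuclideanSpace.single j (1 : ℝ) := by
    ext k; simp [Pi.single_apply]
  conv_lhs => rw [hx]
  refine (norm_sum_le _ _).trans (le_of_eq ?_)
  simp [norm_smul]

/-- The average over `s` of the lattice distance between the two shifted integer parts is exactly
the `ℓ¹` distance of `x` and `y`; the constant `L` is therefore kept. -/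
lemma norm_interp_sub_le {w : (Fin N → ℤ) → Euc m} {C L : ℝ} (hw : ∀ k, ‖w k‖ ≤ C)
    (hL : ∀ k k', ‖w k - w k'‖ ≤ L * ∑ i, |(k i : ℝ) - k' i|) (x y : Euc N) :
    ‖interp w x - interp w y‖ ≤ L * ∑ i, |x i - y i| := by
  unfold interp
  rw [← integral_sub (integrableOn_interp hw x) (integrableOn_interp hw y)]
  have hint : ∀ i, IntegrableOn
      (fun s => |((⌊x i + s⌋ : ℤ) : ℝ) - (⌊y i + s⌋ : ℤ)|) (Ico (0 : ℝ) 1) :=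
    fun i => ((integrableOn_floor _).sub (integrableOn_floor _)).abs
  calc ‖∫ s in Ico (0 : ℝ) 1, (w (floorShift x s) - w (floorShift y s))‖
      ≤ ∫ s in Ico (0 : ℝ) 1, L * ∑ i, |((⌊x i + s⌋ : ℤ) : ℝ) - (⌊y i + s⌋ : ℤ)| := by
        refine norm_integral_le_of_norm_le ?_ (Eventually.of_forall fun s => hL _ _)
        exact (integrable_finsetSum _ fun i _ => hint i).const_mul L
    _ = _ := by
        rw [integral_const_mul, integral_finsetSum _ fun i _ => hint i]
        simp only [setIntegral_abs_floor_sub]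

/-- A telescoping sum. If `i` has the smallest fractional part in the upward closed set `S`, the two
sets in `edgeDiff w (cell x) i` are `S` and `S.erase i`, and the latter is upward closed again. -/
lemma apply_vertex_eq (w : (Fin N → ℤ) → Euc m) {x : Euc N} (hx : IsGood x) (S : Finset (Fin N))
    (hS : ∀ i ∈ S, ∀ j, Int.fract (x i) < Int.fract (x j) → j ∈ S) :
    w (vertex (cell x).1 S) = w (cell x).1 + ∑ i ∈ S, edgeDiff w (cell x) i := by
  classical
  induction S using Finset.strongInduction with
  | H S ih =>
    rcases S.eq_empty_or_nonempty with rfl | hne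
    · simp only [Finset.sum_empty, add_zero]
      congr 1
      ext i; simp [vertex]
    · obtain ⟨i, hi, hmin⟩ := S.exists_min_image (fun i => Int.fract (x i)) hne
      have h1 : (cell x).2.1 i = S := by
        ext j
        simp only [cell, Finset.mem_filter, Finset.mem_univ, true_and]
        constructor
        · intro h
          by_cases hij : i = j
          · exact hij ▸ hi
          · exact hS i hi j (lt_of_le_of_ne h (hx.2 i j hij))
        · exact hmin j
      have h2 : (cell x).2.2 i = S.erase i := by
        ext j
        simp only [cell, Finset.mem_filter, Finset.mem_univ, true_and, Finset.mem_erase]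
        constructor
        · intro h
          exact ⟨fun h' => by subst h'; exact lt_irrefl _ h, hS i hi j h⟩
        · rintro ⟨h, hj⟩
          exact lt_of_le_of_ne (hmin j hj) (hx.2 i j (Ne.symm h))
      have h3 := ih (S.erase i) (Finset.erase_ssubset hi) fun k hk j hkj =>
        Finset.mem_erase.2 ⟨fun h => by
          subst h
          exact absurd (hmin k (Finset.mem_of_mem_erase hk)) (not_le.2 hkj),
          hS k (Finset.mem_of_mem_erase hk) j hkj⟩
      rw [← Finset.add_sum_erase _ _ hi]
      have h4 : edgeDiff w (cell x) i = w (vertex (cell x).1 S) - w (vertex (cell x).1 (S.erase i)) := by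
        rw [edgeDiff, h1, h2]
      rw [h4, h3]
      abel

/-- `z` is in the same simplex as `x`. -/
def SameCell (x z : Euc N) : Prop :=
  (∀ i, ⌊z i⌋ = ⌊x i⌋) ∧ ∀ i j, Int.fract (x i) < Int.fract (x j) → Int.fract (z i) < Int.fract (z j)

lemma SameCell.cell_eq {x z : Euc N} (hx : IsGood x) (h : SameCell x z) : cell z = cell x := by
  have h2 : ∀ i j, Int.fract (z i) < Int.fract (z j) ↔ Int.fract (x i) < Int.fract (x j) := by
    intro i j
    refine ⟨fun hz => ?_, h.2 i j⟩
    by_contra hn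
    have hij : i ≠ j := fun e => by subst e; exact lt_irrefl _ hz
    exact lt_asymm hz (h.2 j i (lt_of_le_of_ne (not_lt.1 hn) (hx.2 j i hij.symm)))
  have h1 : ∀ i j, Int.fract (z i) ≤ Int.fract (z j) ↔ Int.fract (x i) ≤ Int.fract (x j) := by
    intro i j
    rw [← not_lt, ← not_lt, h2]
  simp only [cell, Prod.mk.injEq]
  refine ⟨funext h.1, ?_, ?_⟩
  · funext i; ext j; simp [h1]
  · funext i; ext j; simp [h2]

lemma IsGood.eventually {x : Euc N} (hx : IsGood x) :
    ∀ᶠ z in 𝓝 x, IsGood z ∧ SameCell x z := by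
  have hfl : ∀ᶠ z : Euc N in 𝓝 x, ∀ i, ⌊z i⌋ = ⌊x i⌋ ∧ 0 < Int.fract (z i) := by
    refine eventually_all.2 fun i => ?_
    have hc : Continuous fun z : Euc N => z i := by fun_prop
    have h1 : ∀ᶠ z : Euc N in 𝓝 x, (⌊x i⌋ : ℝ) < z i := by
      refine hc.tendsto x |>.eventually_const_lt ?_
      have := hx.1 i
      rw [← Int.self_sub_floor] at this
      linarith
    have h2 : ∀ᶠ z : Euc N in 𝓝 x, z i < ⌊x i⌋ + 1 :=
      (hc.tendsto x).eventually_lt_const (Int.lt_floor_add_one _)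
    filter_upwards [h1, h2] with z hz1 hz2
    have h3 : ⌊z i⌋ = ⌊x i⌋ := Int.floor_eq_iff.2 ⟨hz1.le, hz2⟩
    refine ⟨h3, ?_⟩
    rw [← Int.self_sub_floor, h3]; linarith
  have hord : ∀ᶠ z : Euc N in 𝓝 x, ∀ i j, Int.fract (x i) < Int.fract (x j) →
      z i - ⌊x i⌋ < z j - ⌊x j⌋ := by
    refine eventually_all.2 fun i => eventually_all.2 fun j => ?_
    by_cases h : Int.fract (x i) < Int.fract (x j)
    · have hc1 : Continuous fun z : Euc N => z i - ⌊x i⌋ := by fun_prop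
      have hc2 : Continuous fun z : Euc N => z j - ⌊x j⌋ := by fun_prop
      filter_upwards [(hc1.tendsto x).eventually_lt (hc2.tendsto x)
        (by rwa [Int.self_sub_floor, Int.self_sub_floor])] with z hz _ using hz
    · exact Eventually.of_forall fun z h' => absurd h' h
  filter_upwards [hfl, hord] with z h1 h2
  have h3 : ∀ i j, Int.fract (x i) < Int.fract (x j) → Int.fract (z i) < Int.fract (z j) := by
    intro i j hij
    have := h2 i j hij
    rwa [← (h1 i).1, ← (h1 j).1, Int.self_sub_floor, Int.self_sub_floor] at this
  refine ⟨⟨fun i => (h1 i).2, fun i j hij => ?_⟩, fun i => (h1 i).1, h3⟩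
  rcases lt_or_gt_of_ne (hx.2 i j hij) with h | h
  · exact (h3 i j h).ne
  · exact (h3 j i h).ne'

/-- This displays `interp w` as an affine function on the whole open simplex of `x`. -/
lemma interp_eq {w : (Fin N → ℤ) → Euc m} {x z : Euc N} (hx : IsGood x) (h : SameCell x z) :
    interp w z = w (cell x).1 + ∑ i, (z i - ⌊x i⌋) • edgeDiff w (cell x) i := by
  classical
  have hpt : ∀ s ∈ Ico (0 : ℝ) 1, w (floorShift z s) = w (cell x).1 +
      ∑ i, (((⌊z i + s⌋ : ℤ) : ℝ) - ⌊x i⌋) • edgeDiff w (cell x) i := by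
    intro s hs
    -- The coordinates that have jumped by time `s` are those with fractional part at least `1 - s`,
    -- an upward closed set.
    have h1 : floorShift z s = vertex (cell x).1 {i | 1 ≤ Int.fract (z i) + s} := by
      funext i
      simp only [floorShift, vertex, cell, floor_add_eq _ hs, h.1 i, Finset.mem_filter,
        Finset.mem_univ, true_and]
    rw [h1, apply_vertex_eq w hx _ fun i hi j hij => by
      simp only [Finset.mem_filter, Finset.mem_univ, true_and] at hi ⊢
      have := h.2 i j hij
      linarith]
    congr 1
    rw [Finset.sum_filter]
    refine Finset.sum_congr rfl fun i _ => ?_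
    rw [floor_add_eq _ hs, h.1 i]
    split_ifs <;> simp
  have hint : ∀ i, IntegrableOn (fun s => (((⌊z i + s⌋ : ℤ) : ℝ) - ⌊x i⌋) • edgeDiff w (cell x) i)
      (Ico (0 : ℝ) 1) := fun i =>
    ((integrableOn_floor (z i)).sub (by simp)).smul_const _
  rw [interp, setIntegral_congr_fun measurableSet_Ico hpt, integral_add (by simp)
    (integrable_finsetSum _ fun i _ => hint i), integral_finsetSum _ fun i _ => hint i]
  congr 1
  · simp
  · refine Finset.sum_congr rfl fun i _ => ?_
    rw [integral_smul_const, integral_sub (integrableOn_floor _) (by simp), setIntegral_floor]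
    simp

lemma hasFDerivAt_interp (w : (Fin N → ℤ) → Euc m) {x : Euc N} (hx : IsGood x) :
    HasFDerivAt (interp w) (cellGrad w (cell x)) x := by
  have h1 : HasFDerivAt (fun z : Euc N => w (cell x).1 +
      ∑ i, (z i - ⌊x i⌋) • edgeDiff w (cell x) i) (cellGrad w (cell x)) x := by
    refine HasFDerivAt.const_add _ (HasFDerivAt.fun_sum fun i _ => ?_)
    exact (((EuclideanSpace.proj i : Euc N →L[ℝ] ℝ).hasFDerivAt).sub_const _).smul_const _
  refine h1.congr_of_eventuallyEq ?_
  filter_upwards [hx.eventually] with z hz using interp_eq hx hz.2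

/-- The exceptional points lie on the countably many hyperplanes `x i = k` and `x i - x j = k`. -/
lemma volume_not_isGood : volume {x : Euc N | ¬ IsGood x} = 0 := by
  have hsub : {x : Euc N | ¬ IsGood x} ⊆
      (⋃ i : Fin N, ⋃ k : ℤ, {x | (EuclideanSpace.proj i : Euc N →L[ℝ] ℝ) x = k}) ∪
      ⋃ r : {r : Fin N × Fin N // r.1 ≠ r.2}, ⋃ k : ℤ,
        {x | (EuclideanSpace.proj r.1.1 - EuclideanSpace.proj r.1.2 : Euc N →L[ℝ] ℝ) x = k} := by
    intro x hx
    simp only [mem_ofPred_eq, IsGood, not_and_or, not_forall, not_lt, not_not] at hx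
    rcases hx with ⟨i, hi⟩ | ⟨i, j, hij, h⟩
    · left
      refine mem_iUnion.2 ⟨i, mem_iUnion.2 ⟨⌊x i⌋, ?_⟩⟩
      have h0 := le_antisymm hi (Int.fract_nonneg _)
      rw [← Int.self_sub_floor] at h0
      exact sub_eq_zero.1 h0
    · right
      refine mem_iUnion.2 ⟨⟨(i, j), hij⟩, mem_iUnion.2 ⟨⌊x i⌋ - ⌊x j⌋, ?_⟩⟩
      rw [← Int.self_sub_floor, ← Int.self_sub_floor] at h
      change x i - x j = _
      push_cast
      linarith
  refine measure_mono_null hsub (measure_union_null ?_ ?_)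
  · refine measure_iUnion_null fun i => measure_iUnion_null fun k =>
      volume_level_eq_zero _ (fun h => ?_) _
    have := DFunLike.congr_fun h (EuclideanSpace.single i (1 : ℝ))
    simp at this
  · refine measure_iUnion_null fun r => measure_iUnion_null fun k =>
      volume_level_eq_zero _ (fun h => ?_) _
    have := DFunLike.congr_fun h (EuclideanSpace.single r.1.1 (1 : ℝ))
    simp [r.2.symm] at this

lemma finite_cell_image {Q : Set (Euc N)} (hQ : Bornology.IsBounded Q) :
    (cell '' Q).Finite := by
  obtain ⟨R, hR⟩ := hQ.subset_closedBall 0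
  have h1 : (univ.pi fun _ : Fin N => Icc ⌊-R⌋ ⌊R⌋).Finite :=
    Set.Finite.pi fun _ => Set.finite_Icc _ _
  refine (h1.prod finite_univ).subset ?_
  rintro _ ⟨x, hx, rfl⟩
  refine ⟨fun i _ => ?_, mem_univ _⟩
  have h2 : |x i| ≤ R := (PiLp.norm_apply_le x i).trans (mem_closedBall_zero_iff.1 (hR hx))
  exact ⟨Int.floor_le_floor (abs_le.1 h2).1, Int.floor_le_floor (abs_le.1 h2).2⟩

end interp

/-! ### From piecewise affine to `C¹` functions by interpolation on fine meshes. -/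

section approx
variable {m N : ℕ}

lemma rankOne_sum_col (ξ : Mat m N) :
    ∑ j, rankOne (ξ (EuclideanSpace.single j 1)) j = ξ := by
  ext x i
  have hx : x = ∑ j, x j • EuclideanSpace.single j (1 : ℝ) := by
    ext k; simp [Pi.single_apply]
  conv_rhs => rw [hx]
  simp [rankOne_apply]

lemma continuous_rankOne (j : Fin N) : Continuous fun a : Euc m => (rankOne a j : Mat m N) :=
  (ContinuousLinearMap.smulRightL ℝ (Euc N) (Euc m) (EuclideanSpace.proj j)).continuous

/-- The interpolation of `u` on the lattice of mesh `1 / n`. -/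
noncomputable def meshInterp (u : Euc N → Euc m) (n : ℕ) (x : Euc N) : Euc m :=
  interp (fun k => u (WithLp.toLp 2 fun i => (k i : ℝ) / n)) ((n : ℝ) • x)

/-- The gradient of `meshInterp u n`. -/
noncomputable def meshGrad (u : Euc N → Euc m) (n : ℕ) (x : Euc N) : Mat m N :=
  (n : ℝ) • cellGrad (fun k => u (WithLp.toLp 2 fun i => (k i : ℝ) / n)) (cell ((n : ℝ) • x))

lemma hasFDerivAt_meshInterp (u : Euc N → Euc m) {n : ℕ} {x : Euc N}
    (hx : IsGood ((n : ℝ) • x)) : HasFDerivAt (meshInterp u n) (meshGrad u n x) x := by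
  have h1 : HasFDerivAt (fun x : Euc N => (n : ℝ) • x)
      ((n : ℝ) • ContinuousLinearMap.id ℝ (Euc N)) x :=
    (hasFDerivAt_id x).const_smul (n : ℝ)
  have h2 := (hasFDerivAt_interp (fun k => u (WithLp.toLp 2 fun i => (k i : ℝ) / n)) hx).comp x h1
  have h3 : (cellGrad (fun k => u (WithLp.toLp 2 fun i => (k i : ℝ) / n))
      (cell ((n : ℝ) • x))).comp ((n : ℝ) • ContinuousLinearMap.id ℝ (Euc N)) = meshGrad u n x := by
    ext y i; simp [meshGrad]
  rw [h3] at h2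
  exact h2

lemma lipschitz_meshInterp {u : Euc N → Euc m} {C : ℝ} {K : ℝ≥0} (hC : ∀ x, ‖u x‖ ≤ C)
    (hK : LipschitzWith K u) {n : ℕ} (hn : 0 < n) :
    LipschitzWith (K * N) (meshInterp u n) := by
  have hn' : (0 : ℝ) < n := by exact_mod_cast hn
  refine LipschitzWith.of_dist_le_mul fun x y => ?_
  rw [dist_eq_norm]
  refine (norm_interp_sub_le (C := C) (L := K / n) (fun k => hC _) (fun k k' => ?_) _ _).trans ?_
  · have h1 := hK.dist_le_mul (WithLp.toLp 2 fun i => (k i : ℝ) / n)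
      (WithLp.toLp 2 fun i => (k' i : ℝ) / n)
    rw [dist_eq_norm, dist_eq_norm] at h1
    refine h1.trans ?_
    rw [div_mul_eq_mul_div, mul_div_assoc]
    gcongr
    refine (norm_le_sum_abs _).trans (le_of_eq ?_)
    rw [Finset.sum_div]
    refine Finset.sum_congr rfl fun i _ => ?_
    simp only [PiLp.sub_apply]
    rw [← sub_div, abs_div, abs_of_pos hn']
  · have h2 : ∑ i, |((n : ℝ) • x) i - ((n : ℝ) • y) i| ≤ n * (N * dist x y) := by
      have : ∀ i ∈ Finset.univ, |((n : ℝ) • x) i - ((n : ℝ) • y) i| ≤ n * dist x y := by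
        intro i _
        simp only [PiLp.smul_apply, smul_eq_mul]
        rw [← mul_sub, abs_mul, abs_of_pos hn', dist_eq_norm]
        gcongr
        exact PiLp.norm_apply_le (x - y) i
      refine (Finset.sum_le_card_nsmul _ _ _ this).trans (le_of_eq ?_)
      simp; ring
    calc (K / n : ℝ) * ∑ i, |((n : ℝ) • x) i - ((n : ℝ) • y) i|
        ≤ (K / n) * (n * (N * dist x y)) := by gcongr
      _ = _ := by push_cast; field_simp

/-- Lattice points in the cell of `n x` rescale to points near `x`. -/
lemma norm_lattice_sub_le {n : ℕ} (hn : 0 < n) (x : Euc N) (k : Fin N → ℤ)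
    (hk : ∀ i, |(k i : ℝ) - n * x i| ≤ 1) :
    ‖(WithLp.toLp 2 fun i => (k i : ℝ) / n : Euc N) - x‖ ≤ N / n := by
  have hn' : (0 : ℝ) < n := by exact_mod_cast hn
  refine (norm_le_sum_abs _).trans ?_
  have : ∀ i ∈ Finset.univ, |((WithLp.toLp 2 fun i => (k i : ℝ) / n : Euc N) - x) i| ≤ 1 / n := by
    intro i _
    simp only [PiLp.sub_apply]
    rw [show (k i : ℝ) / n - x i = (k i - n * x i) / n by field_simp, abs_div, abs_of_pos hn']
    gcongr
    exact hk i
  refine (Finset.sum_le_card_nsmul _ _ _ this).trans (le_of_eq ?_)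
  simp; ring

lemma meshInterp_eq_zero {u : Euc N → Euc m} {R : ℝ} (hu : ∀ x, R ≤ ‖x‖ → u x = 0) {n : ℕ}
    (hn : N < n) {x : Euc N} (hx : R + 1 ≤ ‖x‖) : meshInterp u n x = 0 := by
  have hn0 : 0 < n := by omega
  have hn' : (0 : ℝ) < n := by exact_mod_cast hn0
  rw [meshInterp, interp, setIntegral_congr_fun (g := fun _ => 0) measurableSet_Ico]
  · simp
  intro s hs
  refine hu _ ?_
  have h1 := norm_lattice_sub_le hn0 x (floorShift ((n : ℝ) • x) s) fun i => by
    simp only [floorShift, PiLp.smul_apply, smul_eq_mul]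
    have h1 := Int.floor_le ((n : ℝ) * x i + s)
    have h2 := Int.lt_floor_add_one ((n : ℝ) * x i + s)
    rw [abs_le]
    constructor <;> linarith [hs.1, hs.2]
  have h2 : (N : ℝ) / n ≤ 1 := by
    rw [div_le_one hn']; exact_mod_cast hn.le
  have h3 := norm_sub_norm_le x (WithLp.toLp 2 fun i => (floorShift ((n : ℝ) • x) s i : ℝ) / n)
  rw [norm_sub_rev] at h3
  linarith

/-- The `i`-th column of the gradient is the difference quotient of `u` along an edge parallel to
`e_i` of length `1 / n`. Both endpoints tend to `x`, but `x` need not be one of them; hence strict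
differentiability. -/
lemma tendsto_meshGrad {u : Euc N → Euc m} {u' : Mat m N} {x : Euc N}
    (hu : HasStrictFDerivAt u u' x) (hx : ∀ n : ℕ, 0 < n → IsGood ((n : ℝ) • x)) :
    Tendsto (fun n => meshGrad u n x) atTop (𝓝 u') := by
  let p : Fin N → ℕ → Euc N := fun i n =>
    WithLp.toLp 2 fun j => (vertex (cell ((n : ℝ) • x)).1 ((cell ((n : ℝ) • x)).2.1 i) j : ℝ) / n
  let q : Fin N → ℕ → Euc N := fun i n =>
    WithLp.toLp 2 fun j => (vertex (cell ((n : ℝ) • x)).1 ((cell ((n : ℝ) • x)).2.2 i) j : ℝ) / n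
  have hv : ∀ (n : ℕ) (S : Finset (Fin N)) (i : Fin N),
      |(vertex (cell ((n : ℝ) • x)).1 S i : ℝ) - n * x i| ≤ 1 := by
    intro n S i
    have h1 := Int.floor_le ((n : ℝ) * x i)
    have h2 := Int.lt_floor_add_one ((n : ℝ) * x i)
    simp only [vertex, cell, PiLp.smul_apply, smul_eq_mul]
    rw [abs_le]
    split_ifs <;> push_cast <;> constructor <;> linarith
  have hconv : ∀ y : ℕ → Euc N, (∀ n, 0 < n → ‖y n - x‖ ≤ N / n) → Tendsto y atTop (𝓝 x) := by
    intro y hy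
    rw [tendsto_iff_norm_sub_tendsto_zero]
    refine squeeze_zero' (Eventually.of_forall fun _ => norm_nonneg _) ?_
      (tendsto_const_div_atTop_nhds_zero_nat (N : ℝ))
    filter_upwards [eventually_gt_atTop 0] with n hn using hy n hn
  have hp : ∀ i, Tendsto (p i) atTop (𝓝 x) := fun i =>
    hconv _ fun n hn => norm_lattice_sub_le hn x _ (hv n _)
  have hq : ∀ i, Tendsto (q i) atTop (𝓝 x) := fun i =>
    hconv _ fun n hn => norm_lattice_sub_le hn x _ (hv n _)
  have hpq : ∀ i (n : ℕ), 0 < n → p i n - q i n = (n : ℝ)⁻¹ • EuclideanSpace.single i 1 := by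
    intro i n hn
    ext j
    have hg := hx n hn
    have hmem1 : j ∈ (cell ((n : ℝ) • x)).2.1 i ↔
        Int.fract (((n : ℝ) • x) i) ≤ Int.fract (((n : ℝ) • x) j) := by
      simp only [cell, Finset.mem_filter, Finset.mem_univ, true_and]
    have hmem2 : j ∈ (cell ((n : ℝ) • x)).2.2 i ↔
        Int.fract (((n : ℝ) • x) i) < Int.fract (((n : ℝ) • x) j) := by
      simp only [cell, Finset.mem_filter, Finset.mem_univ, true_and]
    simp only [p, q, vertex, PiLp.sub_apply, PiLp.smul_apply, smul_eq_mul, PiLp.single_apply]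
    by_cases hij : j = i
    · subst hij
      rw [if_pos (hmem1.2 le_rfl), if_neg (fun h => lt_irrefl _ (hmem2.1 h))]
      push_cast
      simp
      ring
    · have : j ∈ (cell ((n : ℝ) • x)).2.1 i ↔ j ∈ (cell ((n : ℝ) • x)).2.2 i := by
        rw [hmem1, hmem2]
        exact ⟨fun h => lt_of_le_of_ne h (hg.2 i j (Ne.symm hij)), le_of_lt⟩
      simp [this, hij]
  have hslope : ∀ i, Tendsto (fun n : ℕ => (n : ℝ) • (u (p i n) - u (q i n))) atTop
      (𝓝 (u' (EuclideanSpace.single i 1))) := by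
    intro i
    have h1 := hu.isLittleO.comp_tendsto ((hp i).prodMk_nhds (hq i))
    rw [tendsto_iff_norm_sub_tendsto_zero]
    have h2 : (fun n : ℕ => (n : ℝ) • (u (p i n) - u (q i n) - u' (p i n - q i n))) =o[atTop]
        fun _ => (1 : ℝ) := by
      have h3 := (Asymptotics.isBigO_refl (fun n : ℕ => (n : ℝ)) atTop).smul_isLittleO h1
      refine h3.trans_isBigO ?_
      refine Asymptotics.IsBigO.of_bound 1 ?_
      filter_upwards [eventually_gt_atTop 0] with n hn
      have hn' : (0 : ℝ) < n := by exact_mod_cast hn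
      simp only [Function.comp_apply, hpq i n hn, smul_smul]
      rw [mul_inv_cancel₀ hn'.ne']
      simp
    have h3 := (Asymptotics.isLittleO_one_iff ℝ).1 h2
    refine (tendsto_zero_iff_norm_tendsto_zero.1 h3).congr' ?_
    filter_upwards [eventually_gt_atTop 0] with n hn
    have hn' : (0 : ℝ) < n := by exact_mod_cast hn
    rw [hpq i n hn, smul_sub, map_smul, smul_smul, mul_inv_cancel₀ hn'.ne', one_smul]
  have h4 : Tendsto (fun n : ℕ => ∑ i, rankOne ((n : ℝ) • (u (p i n) - u (q i n))) i) atTop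
      (𝓝 (∑ i, rankOne (u' (EuclideanSpace.single i 1)) i)) :=
    tendsto_finsetSum _ fun i _ => ((continuous_rankOne i).tendsto _).comp (hslope i)
  rw [rankOne_sum_col] at h4
  refine h4.congr fun n => ?_
  simp only [meshGrad, cellGrad, rankOne_smul]
  rw [Finset.smul_sum]
  rfl

/-- The pieces are indexed by the values of the gradient, not by simplices. There are finitely many
values because only finitely many cells meet a bounded set. -/
lemma pwa_meshInterp {u : Euc N → Euc m} {R C : ℝ} {K : ℝ≥0} (hu : ∀ x, R ≤ ‖x‖ → u x = 0)
    (hC : ∀ x, ‖u x‖ ≤ C) (hK : LipschitzWith K u) {n : ℕ} (hn : N < n) :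
    ∃ S : Finset (Mat m N),
      PWA (Metric.ball 0 (R + 1))
        (fun A : S => {x | x ∈ Metric.ball 0 (R + 1) ∧ IsGood ((n : ℝ) • x) ∧ meshGrad u n x = A})
        (fun A : S => (A : Mat m N)) (meshInterp u n) := by
  classical
  have hn0 : 0 < n := by omega
  have hn' : (0 : ℝ) < n := by exact_mod_cast hn0
  have hfin : (meshGrad u n '' Metric.ball 0 (R + 1)).Finite := by
    have hb : Bornology.IsBounded ((fun x : Euc N => (n : ℝ) • x) '' Metric.ball 0 (R + 1)) := by
      rw [image_smul]
      exact Metric.isBounded_ball.smul₀ _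
    have h1 := finite_cell_image hb
    rw [image_image] at h1
    have h2 := h1.image fun c => (n : ℝ) •
      cellGrad (fun k => u (WithLp.toLp 2 fun i => (k i : ℝ) / n)) c
    rw [image_image] at h2
    exact h2
  refine ⟨hfin.toFinset, ⟨_, lipschitz_meshInterp hC hK hn0⟩, ?_, ?_, ?_, ?_, ?_, ?_⟩
  · intro x hx
    refine meshInterp_eq_zero hu hn ?_
    simpa using hx
  · intro A
    refine isOpen_iff_mem_nhds.2 ?_
    rintro x ⟨hx, hg, hA⟩
    have hc : Continuous fun x : Euc N => (n : ℝ) • x := by fun_prop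
    filter_upwards [Metric.isOpen_ball.mem_nhds hx, (hc.tendsto x).eventually hg.eventually]
      with z hz1 hz2
    refine ⟨hz1, hz2.1, ?_⟩
    rw [← hA, meshGrad, meshGrad, hz2.2.cell_eq hg]
  · exact fun A x hx => hx.1
  · intro A B hAB
    refine Set.disjoint_left.2 fun x hx hx' => hAB (Subtype.ext (hx.2.2.symm.trans hx'.2.2))
  · have hsub : (Metric.ball 0 (R + 1) \ ⋃ A : hfin.toFinset,
        {x | x ∈ Metric.ball 0 (R + 1) ∧ IsGood ((n : ℝ) • x) ∧ meshGrad u n x = A}) ⊆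
        (fun x : Euc N => (n : ℝ) • x) ⁻¹' {x | ¬ IsGood x} := by
      rintro x ⟨hx, hx'⟩ hg
      exact hx' (mem_iUnion.2 ⟨⟨meshGrad u n x, hfin.mem_toFinset.2 (mem_image_of_mem _ hx)⟩,
        hx, hg, rfl⟩)
    refine measure_mono_null hsub ?_
    rw [Measure.addHaar_preimage_smul _ hn'.ne', volume_not_isGood, mul_zero]
  · rintro A x ⟨-, hg, hA⟩
    rw [← hA]
    exact hasFDerivAt_meshInterp u hg

/-- Dominated convergence: the arguments stay in a compact ball, on which the continuous finite `f`
has a finite maximum. -/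
lemma le_lintegral_of_tendsto {f : Mat m N → ℝ≥0∞} (hf : Continuous f) (hfin : ∀ ξ, f ξ < ⊤)
    {Q : Set (Euc N)} (hQ : volume Q ≠ ⊤) {g : ℕ → Euc N → Mat m N} {g' : Euc N → Mat m N}
    (hg : ∀ n, AEMeasurable (g n) (volume.restrict Q)) {K : ℝ}
    (hK : ∀ n, ∀ᵐ x ∂volume.restrict Q, ‖g n x‖ ≤ K)
    (hlim : ∀ᵐ x ∂volume.restrict Q, Tendsto (fun n => g n x) atTop (𝓝 (g' x)))
    {c : ℝ≥0∞} (ξ : Mat m N) (hc : ∀ n, c ≤ ∫⁻ x in Q, f (ξ + g n x)) :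
    c ≤ ∫⁻ x in Q, f (ξ + g' x) := by
  have : ProperSpace (Mat m N) := FiniteDimensional.proper ℝ (Mat m N)
  obtain ⟨A, -, hA⟩ := (isCompact_closedBall ξ |K|).exists_isMaxOn
    (Metric.nonempty_closedBall.2 (abs_nonneg K)) hf.continuousOn
  have hcont : Continuous fun B : Mat m N => f (ξ + B) := hf.comp (continuous_const.add continuous_id)
  have hlim' : Tendsto (fun n => ∫⁻ x in Q, f (ξ + g n x)) atTop (𝓝 (∫⁻ x in Q, f (ξ + g' x))) := by
    refine tendsto_lintegral_of_dominated_convergence' (fun _ => f A)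
      (fun n => hcont.measurable.comp_aemeasurable (hg n)) (fun n => ?_) ?_ ?_
    · filter_upwards [hK n] with x hx
      refine hA ?_
      rw [mem_closedBall_iff_norm]
      simpa using hx.trans (le_abs_self K)
    · rw [setLIntegral_const]
      exact ENNReal.mul_ne_top (hfin A).ne hQ
    · filter_upwards [hlim] with x hx using (hcont.tendsto _).comp hx
  exact ge_of_tendsto' hlim' hc

theorem AffQC.le_lintegral_of_contDiff {f : Mat m N → ℝ≥0∞} (hf : AffQC f)
    (hfin : ∀ ξ, f ξ < ⊤) {u : Euc N → Euc m} (hu : ContDiff ℝ 1 u) {R : ℝ} (hR : 0 < R)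
    (huR : ∀ x, R ≤ ‖x‖ → u x = 0) (ξ : Mat m N) :
    f ξ * volume (Metric.ball (0 : Euc N) (R + 1)) ≤
      ∫⁻ x in Metric.ball 0 (R + 1), f (ξ + fderiv ℝ u x) := by
  have hcs : HasCompactSupport u := HasCompactSupport.intro (isCompact_closedBall (0 : Euc N) R)
    fun x hx => huR x (by simpa using (not_le.1 (fun h => hx (mem_closedBall_zero_iff.2 h))).le)
  obtain ⟨K, hK⟩ := hu.lipschitzWith_of_hasCompactSupport hcs one_ne_zero
  obtain ⟨C, hC⟩ := hcs.exists_bound_of_continuous hu.continuous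
  refine le_lintegral_of_tendsto (K := (K * N : ℝ≥0)) (hf.continuous hfin) hfin
    Metric.isBounded_ball.measure_lt_top.ne
    -- The offset makes `N / (N + 1 + n) ≤ 1`, so that every interpolant vanishes off the ball of
    -- radius `R + 1`.
    (g := fun n => fderiv ℝ (meshInterp u (N + 1 + n)))
    (fun n => (measurable_fderiv ℝ _).aemeasurable) (fun n => Eventually.of_forall fun x => ?_) ?_ ξ
    fun n => ?_
  · exact norm_fderiv_le_of_lipschitz ℝ (lipschitz_meshInterp hC hK (by omega))
  · have hgood : ∀ᵐ x : Euc N, ∀ n : ℕ, 0 < n → IsGood ((n : ℝ) • x) := by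
      refine ae_all_iff.2 fun n => ?_
      by_cases hn : 0 < n
      · have hn' : (n : ℝ) ≠ 0 := by exact_mod_cast hn.ne'
        have : volume ((fun x : Euc N => (n : ℝ) • x) ⁻¹' {x | ¬ IsGood x}) = 0 := by
          rw [Measure.addHaar_preimage_smul _ hn', volume_not_isGood, mul_zero]
        exact measure_mono_null (fun x hx h => hx fun _ => h) this
      · exact Eventually.of_forall fun x h => absurd h hn
    filter_upwards [ae_restrict_of_ae hgood] with x hx
    have h1 := tendsto_meshGrad (hu.contDiffAt.hasStrictFDerivAt one_ne_zero) hx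
    refine (h1.comp (tendsto_add_atTop_nat (N + 1))).congr fun n => ?_
    simp only [Function.comp_apply]
    rw [add_comm n, (hasFDerivAt_meshInterp u (hx (N + 1 + n) (by omega))).fderiv]
  · obtain ⟨S, hS⟩ := pwa_meshInterp huR hC hK (n := N + 1 + n) (by omega)
    rw [hS.lintegral (fun B => f (ξ + B))]
    refine hf ξ _ Metric.isOpen_ball (Metric.nonempty_ball.2 (by linarith)) Metric.isBounded_ball ?_
      _ _ _ _ hS
    exact (convex_ball _ _).addHaar_frontier _

end approx

/-! ### Integration by parts for functions of zero trace. -/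

section ibp
variable {m N : ℕ} {D : Set (Euc N)}

lemma tendsto_setIntegral_clm {F F' : Type*} [NormedAddCommGroup F] [NormedSpace ℝ F]
    [NormedAddCommGroup F'] [NormedSpace ℝ F'] {B : Euc N → F →L[ℝ] F'} (hB : Continuous B)
    {C : ℝ} (hC : ∀ x, ‖B x‖ ≤ C) {u : ℕ → Euc N → F} {u' : Euc N → F}
    (hu : ∀ n, IntegrableOn (u n) D) (hu' : IntegrableOn u' D)
    (h : Tendsto (fun n => eLpNorm (fun x => u n x - u' x) 1 (volume.restrict D)) atTop (𝓝 0)) :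
    Tendsto (fun n => ∫ x in D, B x (u n x)) atTop (𝓝 (∫ x in D, B x (u' x))) := by
  have hint : ∀ {v : Euc N → F}, IntegrableOn v D → IntegrableOn (fun x => B x (v x)) D := by
    intro v hv
    refine Integrable.mono' (hv.norm.const_mul C) ?_ (Eventually.of_forall fun x => ?_)
    · exact (ContinuousLinearMap.apply ℝ F').aestronglyMeasurable_comp₂ hv.1
        hB.aestronglyMeasurable
    · exact ((B x).le_opNorm _).trans (mul_le_mul_of_nonneg_right (hC x) (norm_nonneg _))
  refine tendsto_integral_of_L1' _ (hint hu').1 (Eventually.of_forall fun n => hint (hu n)) ?_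
  have h1 : Tendsto (fun n => ENNReal.ofReal C *
      eLpNorm (fun x => u n x - u' x) 1 (volume.restrict D)) atTop (𝓝 0) := by
    have := ENNReal.Tendsto.const_mul (a := ENNReal.ofReal C) h (Or.inr ENNReal.ofReal_ne_top)
    rwa [mul_zero] at this
  refine tendsto_of_tendsto_of_tendsto_of_le_of_le tendsto_const_nhds h1 (fun _ => zero_le)
    fun n => ?_
  refine eLpNorm_le_mul_eLpNorm_of_ae_le_mul (Eventually.of_forall fun x => ?_) 1
  simp only [Pi.sub_apply]
  rw [← map_sub]
  exact ((B x).le_opNorm _).trans (mul_le_mul_of_nonneg_right (hC x) (norm_nonneg _))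

/-- Integration by parts for `W^{1,1}_0`; the test function need not vanish near `∂D`. -/
theorem IsSobolevOneZero.integral_fderiv_smul {φ : Euc N → Euc m} {G : Euc N → Mat m N}
    (h : IsSobolevOneZero D φ G) (hφ : IntegrableOn φ D) (hG : IntegrableOn G D)
    {η : Euc N → ℝ} (hη : ContDiff ℝ 1 η) (hηc : HasCompactSupport η) (v : Euc N) :
    ∫ x in D, (fderiv ℝ η x v) • φ x = - ∫ x in D, η x • G x v := by
  obtain ⟨ψ, hψ, hψ1, hψ2⟩ := h
  obtain ⟨C1, hC1⟩ := hηc.exists_bound_of_continuous hη.continuous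
  have hηd : Continuous (fderiv ℝ η) := hη.continuous_fderiv one_ne_zero
  obtain ⟨C2, hC2⟩ := (hηc.fderiv ℝ).exists_bound_of_continuous hηd
  have hψd : ∀ n, Continuous (fderiv ℝ (ψ n)) := fun n => (hψ n).1.continuous_fderiv (by simp)
  have hψi : ∀ n, Integrable (ψ n) := fun n =>
    (hψ n).1.continuous.integrable_of_hasCompactSupport (hψ n).2.1
  have hψdi : ∀ n, Integrable (fderiv ℝ (ψ n)) := fun n =>
    (hψd n).integrable_of_hasCompactSupport ((hψ n).2.1.fderiv ℝ)
  have hηv : Continuous fun x => fderiv ℝ η x v := hηd.clm_apply continuous_const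
  have h1 := tendsto_setIntegral_clm
    (B := fun x => (fderiv ℝ η x v) • ContinuousLinearMap.id ℝ (Euc m)) (C := C2 * ‖v‖)
    (hηv.smul continuous_const) (fun x => by
      rw [norm_smul]
      refine (mul_le_of_le_one_right (norm_nonneg _) ContinuousLinearMap.norm_id_le).trans ?_
      exact ((fderiv ℝ η x).le_opNorm v).trans
        (mul_le_mul_of_nonneg_right (hC2 x) (norm_nonneg _)))
    (fun n => (hψi n).integrableOn) hφ hψ1
  have h2 := tendsto_setIntegral_clm
    (B := fun x => η x • ContinuousLinearMap.apply ℝ (Euc m) v) (C := C1 * ‖v‖)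
    (hη.continuous.smul continuous_const) (fun x => by
      rw [norm_smul]
      refine mul_le_mul (hC1 x) ?_ (norm_nonneg _) ((norm_nonneg _).trans (hC1 x))
      refine ContinuousLinearMap.opNorm_le_bound _ (norm_nonneg _) fun A => ?_
      rw [mul_comm]; exact A.le_opNorm v)
    (fun n => (hψdi n).integrableOn) hG hψ2
  -- Each `ψ n` has its support in `D`, so the integrals extend to the whole space, where no
  -- boundary term arises.
  have h3 : ∀ n, ∫ x in D, (fderiv ℝ η x v) • ψ n x = - ∫ x in D, η x • fderiv ℝ (ψ n) x v := by
    intro n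
    have hz : ∀ x, x ∉ D → ψ n x = 0 := fun x hx =>
      image_eq_zero_of_notMem_tsupport fun h => hx ((hψ n).2.2 h)
    have hz' : ∀ x, x ∉ D → fderiv ℝ (ψ n) x = 0 := fun x hx =>
      image_eq_zero_of_notMem_tsupport fun h => hx ((hψ n).2.2 (tsupport_fderiv_subset ℝ h))
    rw [setIntegral_eq_integral_of_forall_compl_eq_zero fun x hx => by rw [hz x hx, smul_zero],
      setIntegral_eq_integral_of_forall_compl_eq_zero fun x hx => by rw [hz' x hx]; simp]
    have hψv : Continuous fun x => fderiv ℝ (ψ n) x v := (hψd n).clm_apply continuous_const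
    rw [integral_smul_fderiv_eq_neg_fderiv_smul_of_integrable, neg_neg]
    · exact (hηv.smul (hψ n).1.continuous).integrable_of_hasCompactSupport ((hψ n).2.1.smul_left)
    · exact (hη.continuous.smul hψv).integrable_of_hasCompactSupport (hηc.smul_right)
    · exact (hη.continuous.smul (hψ n).1.continuous).integrable_of_hasCompactSupport
        (hηc.smul_right)
    · exact fun x _ => hη.differentiable one_ne_zero x
    · exact fun x _ => (hψ n).1.differentiable (by simp) x
  have h4 := h1
  simp only [smul_apply, ContinuousLinearMap.id_apply,
    ContinuousLinearMap.apply_apply, h3] at h4 h2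
  exact tendsto_nhds_unique h4 h2.neg

end ibp

/-! ### From `C¹` to `W^{1,∞}_0` functions by mollification; quasiconvexity. -/

section mollify
variable {m N : ℕ} {D : Set (Euc N)}
open scoped Convolution

/-- The derivative of the convolution falls on the kernel; testing the weak gradient with `t ↦ ρ (x
- t)` moves it over to `φ`. -/
lemma hasFDerivAt_convolution_of_weak {E F : Type*} [NormedAddCommGroup E] [NormedSpace ℝ E]
    [FiniteDimensional ℝ E] [MeasurableSpace E] [BorelSpace E] {μ : Measure E}
    [μ.IsAddHaarMeasure] [NormedAddCommGroup F] [NormedSpace ℝ F] [CompleteSpace F]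
    {φ : E → F} {G : E → E →L[ℝ] F} (hφ : Integrable φ μ) (hG : Integrable G μ)
    (h : ∀ η : E → ℝ, ContDiff ℝ 1 η → HasCompactSupport η → ∀ v : E,
      ∫ x, (fderiv ℝ η x v) • φ x ∂μ = - ∫ x, η x • G x v ∂μ)
    {ρ : E → ℝ} (hρ : ContDiff ℝ 1 ρ) (hρc : HasCompactSupport ρ) (x : E) :
    HasFDerivAt (ρ ⋆[ContinuousLinearMap.lsmul ℝ ℝ, μ] φ)
      ((ρ ⋆[ContinuousLinearMap.lsmul ℝ ℝ, μ] G) x) x := by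
  have h1 := hρc.hasFDerivAt_convolution_left (ContinuousLinearMap.lsmul ℝ ℝ) hρ
    hφ.locallyIntegrable x
  convert h1 using 1
  refine ContinuousLinearMap.ext fun v => ?_
  have e1 : ((ρ ⋆[ContinuousLinearMap.lsmul ℝ ℝ, μ] G) x) v =
      ∫ t, ρ (x - t) • G t v ∂μ := by
    have hex := hρc.convolutionExists_left (ContinuousLinearMap.lsmul ℝ ℝ) hρ.continuous
      hG.locallyIntegrable x
    rw [convolution_lsmul_swap, ContinuousLinearMap.integral_apply]
    · rfl
    · exact hex.integrable_swap
  have e2 : ((fderiv ℝ ρ ⋆[(ContinuousLinearMap.lsmul ℝ ℝ).precompL E, μ] φ) x) v =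
      ∫ t, fderiv ℝ ρ (x - t) v • φ t ∂μ := by
    have hex := (hρc.fderiv ℝ).convolutionExists_left ((ContinuousLinearMap.lsmul ℝ ℝ).precompL E)
      (hρ.continuous_fderiv one_ne_zero) hφ.locallyIntegrable x
    rw [convolution_eq_swap, ContinuousLinearMap.integral_apply]
    · rfl
    · exact hex.integrable_swap
  rw [e1, e2]
  have hη : ContDiff ℝ 1 fun t => ρ (x - t) := hρ.comp (contDiff_const.sub contDiff_id)
  have hηc : HasCompactSupport fun t => ρ (x - t) := hρc.comp_homeomorph (Homeomorph.subLeft x)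
  have h2 := h _ hη hηc v
  have h3 : ∀ t, fderiv ℝ (fun t => ρ (x - t)) t v = - fderiv ℝ ρ (x - t) v := by
    intro t
    have h4 : HasFDerivAt (fun t : E => x - t) (-(ContinuousLinearMap.id ℝ E)) t :=
      (hasFDerivAt_id t).const_sub x
    have h5 := ((hρ.differentiable one_ne_zero (x - t)).hasFDerivAt.comp t h4).fderiv
    have h6 : (fun t => ρ (x - t)) = ρ ∘ fun t => x - t := rfl
    rw [h6, h5]
    simp
  simp only [h3, neg_smul, integral_neg, neg_inj] at h2
  exact h2.symm

lemma exists_mollification {E F : Type*} [NormedAddCommGroup E] [NormedSpace ℝ E]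
    [FiniteDimensional ℝ E] [MeasurableSpace E] [BorelSpace E] {μ : Measure E}
    [μ.IsAddHaarMeasure] [NormedAddCommGroup F] [NormedSpace ℝ F] [CompleteSpace F]
    {φ : E → F} {G : E → E →L[ℝ] F} (hφ : Integrable φ μ) (hG : Integrable G μ)
    (h : ∀ η : E → ℝ, ContDiff ℝ 1 η → HasCompactSupport η → ∀ v : E,
      ∫ x, (fderiv ℝ η x v) • φ x ∂μ = - ∫ x, η x • G x v ∂μ)
    {R M : ℝ} (hR : ∀ x, R < ‖x‖ → φ x = 0) (hM : ∀ᵐ x ∂μ, ‖G x‖ ≤ M) :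
    ∃ u : ℕ → E → F, (∀ n, ContDiff ℝ 1 (u n)) ∧ (∀ n x, R + 1 ≤ ‖x‖ → u n x = 0) ∧
      (∀ n x, ‖fderiv ℝ (u n) x‖ ≤ M) ∧
      ∀ᵐ x ∂μ, Tendsto (fun n => fderiv ℝ (u n) x) atTop (𝓝 (G x)) := by
  -- The outer radius is at most `1`, which keeps the supports in the ball of radius `R + 1`. The
  -- fixed ratio `2` of the radii is what the almost everywhere convergence at Lebesgue points
  -- requires.
  let ρ : ℕ → ContDiffBump (0 : E) := fun n =>
    ⟨1 / (n + 2), 2 / (n + 2), by positivity, by gcongr; norm_num⟩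
  let u : ℕ → E → F := fun n => (ρ n).normed μ ⋆[ContinuousLinearMap.lsmul ℝ ℝ, μ] φ
  let g : ℕ → E → E →L[ℝ] F := fun n => (ρ n).normed μ ⋆[ContinuousLinearMap.lsmul ℝ ℝ, μ] G
  have hug : ∀ n x, fderiv ℝ (u n) x = g n x := fun n x =>
    (hasFDerivAt_convolution_of_weak hφ hG h (ρ n).contDiff_normed
      (ρ n).hasCompactSupport_normed x).fderiv
  refine ⟨u, fun n => (ρ n).hasCompactSupport_normed.contDiff_convolution_left _
    (ρ n).contDiff_normed hφ.locallyIntegrable, fun n x hx => ?_, fun n x => ?_, ?_⟩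
  · refine integral_eq_zero_of_ae (Eventually.of_forall fun t => ?_)
    by_cases ht : t ∈ Function.support ((ρ n).normed μ)
    · rw [(ρ n).support_normed_eq, mem_ball_zero_iff] at ht
      have h1 : (2 : ℝ) / (n + 2) ≤ 1 := by
        rw [div_le_one (by positivity)]; linarith [(Nat.cast_nonneg n : (0 : ℝ) ≤ n)]
      have h2 : φ (x - t) = 0 := by
        refine hR _ ?_
        have h4 := norm_sub_norm_le x t
        have h5 : ‖t‖ < 2 / (n + 2) := ht
        linarith
      simp [h2]
    · rw [Function.notMem_support] at ht
      simp [ht]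
  · have h1 : g n x = ∫ t, (ρ n).normed μ (x - t) • G t ∂μ := convolution_lsmul_swap
    have h2 : ∫ t, (ρ n).normed μ (x - t) * M ∂μ = M := by
      rw [integral_mul_const, integral_sub_left_eq_self (fun t => (ρ n).normed μ t) μ x,
        (ρ n).integral_normed, one_mul]
    rw [hug, h1, ← h2]
    refine norm_integral_le_of_norm_le ?_ ?_
    · exact (((ρ n).continuous_normed.integrable_of_hasCompactSupport
        (ρ n).hasCompactSupport_normed).comp_sub_left x).mul_const M
    · filter_upwards [hM] with t ht
      rw [norm_smul, Real.norm_eq_abs, abs_of_nonneg ((ρ n).nonneg_normed _)]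
      exact mul_le_mul_of_nonneg_left ht ((ρ n).nonneg_normed _)
  · simp only [hug]
    refine ContDiffBump.ae_convolution_tendsto_right_of_locallyIntegrable (K := 2) ?_
      (Eventually.of_forall fun n => ?_) hG.locallyIntegrable
    · change Tendsto (fun n : ℕ => (2 : ℝ) / (n + 2)) atTop (𝓝 0)
      have := (tendsto_const_div_atTop_nhds_zero_nat (2 : ℝ)).comp (tendsto_add_atTop_nat 2)
      refine this.congr fun n => ?_
      simp
    · change (2 : ℝ) / (n + 2) ≤ 2 * (1 / (n + 2)); rw [mul_one_div]

lemma integrable_indicator_of_integrableOn {E F : Type*} [MeasurableSpace E] [NormedAddCommGroup F]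
    {μ : Measure E} {D : Set E} (hD : MeasurableSet D) (f : E → F) (hf : IntegrableOn f D μ) :
    Integrable (D.indicator f) μ :=
  hf.integrable_indicator hD

/-- The test functions in the hypothesis need not be supported in `D`. This encodes the zero trace,
and it makes the extension of `G` by zero the weak gradient of the extension of `φ`. -/
lemma exists_mollification_of_integrableOn {E F : Type*} [NormedAddCommGroup E] [NormedSpace ℝ E]
    [FiniteDimensional ℝ E] [MeasurableSpace E] [BorelSpace E] {μ : Measure E}
    [μ.IsAddHaarMeasure] [NormedAddCommGroup F] [NormedSpace ℝ F] [CompleteSpace F]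
    {D : Set E} (hD : IsOpen D) {φ : E → F} {G : E → E →L[ℝ] F}
    (hφ : IntegrableOn φ D μ) (hG : IntegrableOn G D μ)
    (h : ∀ η : E → ℝ, ContDiff ℝ 1 η → HasCompactSupport η → ∀ v : E,
      ∫ x in D, (fderiv ℝ η x v) • φ x ∂μ = - ∫ x in D, η x • G x v ∂μ)
    {R M : ℝ} (hR : D ⊆ Metric.closedBall 0 R) (hM0 : 0 ≤ M)
    (hM : ∀ᵐ x ∂μ.restrict D, ‖G x‖ ≤ M) :
    ∃ u : ℕ → E → F, (∀ n, ContDiff ℝ 1 (u n)) ∧ (∀ n x, R + 1 ≤ ‖x‖ → u n x = 0) ∧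
      (∀ n x, ‖fderiv ℝ (u n) x‖ ≤ M) ∧
      ∀ᵐ x ∂μ, (x ∈ D → Tendsto (fun n => fderiv ℝ (u n) x) atTop (𝓝 (G x))) ∧
        (x ∉ D → Tendsto (fun n => fderiv ℝ (u n) x) atTop (𝓝 0)) := by
  have hM' : ∀ᵐ x ∂μ, ‖D.indicator G x‖ ≤ M := by
    filter_upwards [(ae_restrict_iff' hD.measurableSet).1 hM] with x hx
    by_cases hxD : x ∈ D
    · simpa [hxD] using hx hxD
    · simpa [hxD] using hM0
  have hφ' : Integrable (D.indicator φ) μ := hφ.integrable_indicator hD.measurableSet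
  have hG' : Integrable (D.indicator G) μ :=
    integrable_indicator_of_integrableOn hD.measurableSet G hG
  obtain ⟨u, hu1, hu2, hu3, hu4⟩ := exists_mollification hφ' hG' (fun η hη hηc v => by
      have h1 := h η hη hηc v
      rw [← integral_indicator hD.measurableSet, ← integral_indicator hD.measurableSet] at h1
      have e1 : (fun x => (fderiv ℝ η x v) • D.indicator φ x) =
          D.indicator fun x => (fderiv ℝ η x v) • φ x := by
        ext1 x; by_cases hx : x ∈ D <;> simp [hx]
      have e2 : (fun x => η x • D.indicator G x v) = D.indicator fun x => η x • G x v := by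
        ext1 x; by_cases hx : x ∈ D <;> simp [hx]
      rw [e1, e2, h1]) (R := R) (fun x hx => indicator_of_notMem (fun h =>
      not_lt.2 (mem_closedBall_zero_iff.1 (hR h)) hx) _) hM'
  refine ⟨u, hu1, hu2, hu3, ?_⟩
  filter_upwards [hu4] with x hx
  exact ⟨fun h => by simpa [h] using hx, fun h => by simpa [h] using hx⟩

lemma AffQC.le_lintegral_indicator {f : Mat m N → ℝ≥0∞} (hf : AffQC f) (hfin : ∀ ξ, f ξ < ⊤)
    (hDo : IsOpen D) (hDb : Bornology.IsBounded D) {φ : Euc N → Euc m} {G : Euc N → Mat m N}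
    (hφG : IsSobolevInftyZero D φ G) (ξ : Mat m N) :
    ∃ R : ℝ, D ⊆ Metric.ball 0 R ∧ f ξ * volume (Metric.ball (0 : Euc N) R) ≤
      ∫⁻ x in Metric.ball 0 R, f (ξ + D.indicator G x) := by
  have hfinm : IsFiniteMeasure (volume.restrict D) := ⟨by simpa using hDb.measure_lt_top⟩
  have hφi : IntegrableOn φ D := hφG.1.memLp.integrable le_top
  have hGi : IntegrableOn G D := hφG.1.memLp_grad.integrable le_top
  have hM : ∀ᵐ x ∂volume.restrict D, ‖G x‖ ≤ (eLpNorm G ∞ (volume.restrict D)).toReal := by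
    have h1 := hφG.1.memLp_grad.2
    rw [eLpNorm_exponent_top] at h1 ⊢
    filter_upwards [ae_le_eLpNormEssSup (f := G) (μ := volume.restrict D)] with x hx
    rw [← toReal_enorm]
    exact ENNReal.toReal_mono h1.ne hx
  obtain ⟨R, hR, hDR⟩ := hDb.subset_closedBall_lt 0 0
  obtain ⟨u, hus, hu0, huM, hlim⟩ := exists_mollification_of_integrableOn hDo hφi hGi
    (fun η hη hηc v => hφG.2.integral_fderiv_smul hφi hGi hη hηc v) hDR ENNReal.toReal_nonneg hM
  refine ⟨R + 1 + 1, hDR.trans (Metric.closedBall_subset_ball (by linarith)),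
    le_lintegral_of_tendsto (hf.continuous hfin) hfin Metric.isBounded_ball.measure_lt_top.ne
      (fun n => (measurable_fderiv ℝ (u n)).aemeasurable)
      (fun n => Eventually.of_forall (huM n)) (ae_restrict_of_ae ?_) ξ fun n =>
        hf.le_lintegral_of_contDiff hfin (hus n) (by linarith) (hu0 n) ξ⟩
  filter_upwards [hlim] with x hx
  by_cases h : x ∈ D
  · rw [indicator_of_mem h]; exact hx.1 h
  · rw [indicator_of_notMem h]; exact hx.2 h

/-- On a ball containing `D`, the extended gradient vanishes off `D`. There the integrand is the
finite constant `f ξ`, which cancels from both sides. No regularity of `∂D` enters. -/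
theorem AffQC.isQuasiconvex {f : Mat m N → ℝ≥0∞} (hf : AffQC f) (hfin : ∀ ξ, f ξ < ⊤) :
    IsQuasiconvex f := by
  refine ⟨(hf.continuous hfin).measurable, fun ξ D hDo hDne hDb _ φ G hφG => ?_⟩
  have hvD0 : volume D ≠ 0 := (hDo.measure_pos volume hDne).ne'
  have hvDt : volume D ≠ ⊤ := hDb.measure_lt_top.ne
  obtain ⟨R, hDQ, hmain⟩ := hf.le_lintegral_indicator hfin hDo hDb hφG ξ
  set Q : Set (Euc N) := Metric.ball 0 R with hQ
  have hvQ : volume Q ≠ ⊤ := Metric.isBounded_ball.measure_lt_top.ne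
  have hsplit : ∫⁻ x in Q, f (ξ + D.indicator G x) =
      (∫⁻ x in D, f (ξ + G x)) + f ξ * volume (Q \ D) := by
    rw [← lintegral_inter_add_sdiff (fun x => f (ξ + D.indicator G x)) Q hDo.measurableSet,
      inter_eq_self_of_subset_right hDQ]
    congr 1
    · exact setLIntegral_congr_fun hDo.measurableSet fun x hx => by simp [hx]
    · rw [setLIntegral_congr_fun (g := fun _ => f ξ)
        (Metric.isOpen_ball.measurableSet.diff hDo.measurableSet) fun x hx => by simp [hx.2],
        setLIntegral_const]
  have hvol : volume Q = volume D + volume (Q \ D) := by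
    rw [← measure_inter_add_sdiff Q hDo.measurableSet, inter_eq_self_of_subset_right hDQ]
  rw [hsplit, hvol, mul_add] at hmain
  have h1 : f ξ * volume D ≤ ∫⁻ x in D, f (ξ + G x) :=
    (ENNReal.add_le_add_iff_right (ENNReal.mul_ne_top (hfin ξ).ne
      (measure_ne_top_of_subset sdiff_subset hvQ))).1 hmain
  rw [mul_comm, ← div_eq_mul_inv, ENNReal.le_div_iff_mul_le (Or.inl hvD0) (Or.inl hvDt)]
  exact h1

end mollify

/-! ### Smoothing of Lipschitz maps. -/

section lipschitz
open scoped Convolution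

/-- Averaging with an even kernel is not needed: differences `ψ y - ψ x` are averages of translated
differences of `g`, so Lipschitz bounds are inherited, and so is the slope wherever `g` is affine on
a ball larger than the kernel. -/
lemma LipschitzWith.exists_smooth_approx {E F : Type*} [NormedAddCommGroup E] [NormedSpace ℝ E]
    [FiniteDimensional ℝ E] [NormedAddCommGroup F] [NormedSpace ℝ F] [CompleteSpace F]
    {g : E → F} {K : ℝ≥0} (hg : LipschitzWith K g) {ε : ℝ} (hε : 0 < ε) :
    ∃ ψ : E → F, ContDiff ℝ ∞ ψ ∧ LipschitzWith K ψ ∧ (∀ x, ‖ψ x - g x‖ ≤ K * ε) ∧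
      (∀ x, (∀ z ∈ Metric.ball x ε, g z = 0) → ψ x = 0) ∧
      ∀ (x : E) (A : E →L[ℝ] F) (r : ℝ), ε < r →
        (∀ p ∈ Metric.ball x r, ∀ q ∈ Metric.ball x r, g p - g q = A (p - q)) →
        HasFDerivAt ψ A x := by
  borelize E
  let μ : Measure E := Measure.addHaar
  let ρ : ContDiffBump (0 : E) := ⟨ε / 2, ε, by positivity, by linarith⟩
  let ψ : E → F := ρ.normed μ ⋆[ContinuousLinearMap.lsmul ℝ ℝ, μ] g
  have hloc : LocallyIntegrable g μ := hg.continuous.locallyIntegrable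
  have hex : ∀ x, Integrable (fun z => ρ.normed μ z • g (x - z)) μ := fun x =>
    ρ.hasCompactSupport_normed.convolutionExists_left (ContinuousLinearMap.lsmul ℝ ℝ)
      ρ.continuous_normed hloc x
  have hψ : ∀ x, ψ x = ∫ z, ρ.normed μ z • g (x - z) ∂μ := fun x => rfl
  have hsub : ∀ x y, ψ x - ψ y = ∫ z, ρ.normed μ z • (g (x - z) - g (y - z)) ∂μ := by
    intro x y
    rw [hψ, hψ, ← integral_sub (hex x) (hex y)]
    simp only [smul_sub]
  have hsupp : ∀ z, ρ.normed μ z ≠ 0 → ‖z‖ < ε := by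
    intro z hz
    have h1 : z ∈ Function.support (ρ.normed μ) := hz
    rw [ρ.support_normed_eq, mem_ball_zero_iff] at h1
    exact h1
  refine ⟨ψ, ρ.hasCompactSupport_normed.contDiff_convolution_left _ ρ.contDiff_normed hloc,
    LipschitzWith.of_dist_le_mul fun x y => ?_, fun x => ?_, fun x hx => ?_,
    fun x A r hr hA => ?_⟩
  · have h2 : ∫ z, ρ.normed μ z * (K * dist x y) ∂μ = K * dist x y := by
      rw [integral_mul_const, ρ.integral_normed, one_mul]
    rw [dist_eq_norm, hsub, ← h2]
    refine norm_integral_le_of_norm_le ?_ (Eventually.of_forall fun z => ?_)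
    · exact (ρ.continuous_normed.integrable_of_hasCompactSupport
        ρ.hasCompactSupport_normed).mul_const _
    · rw [norm_smul, Real.norm_eq_abs, abs_of_nonneg (ρ.nonneg_normed _)]
      refine mul_le_mul_of_nonneg_left ?_ (ρ.nonneg_normed _)
      have := hg.dist_le_mul (x - z) (y - z)
      rwa [dist_sub_right, dist_eq_norm] at this
  · rw [← dist_eq_norm]
    refine ρ.dist_normed_convolution_le hloc.aestronglyMeasurable fun z hz => ?_
    refine (hg.dist_le_mul z x).trans ?_
    gcongr
    exact (Metric.mem_ball.1 hz).le
  · rw [hψ]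
    refine integral_eq_zero_of_ae (Eventually.of_forall fun z => ?_)
    by_cases hz : ρ.normed μ z = 0
    · simp [hz]
    · have h1 : g (x - z) = 0 := hx _ (by simpa [dist_eq_norm] using hsupp z hz)
      simp [h1]
  · have hlin : ∀ y ∈ Metric.ball x (r - ε), ψ y = ψ x + A (y - x) := by
      intro y hy
      rw [← sub_eq_iff_eq_add', hsub]
      have h1 : ∀ z, ρ.normed μ z • (g (y - z) - g (x - z)) = ρ.normed μ z • A (y - x) := by
        intro z
        by_cases hz : ρ.normed μ z = 0
        · simp [hz]
        · have hz' := hsupp z hz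
          rw [hA (y - z) _ (x - z) _, sub_sub_sub_cancel_right]
          · rw [mem_ball_iff_norm] at hy ⊢
            calc ‖y - z - x‖ = ‖(y - x) - z‖ := by congr 1; abel
              _ ≤ ‖y - x‖ + ‖z‖ := _root_.norm_sub_le _ _
              _ < r := by linarith
          · rw [mem_ball_iff_norm]
            simp only [sub_sub_cancel_left, norm_neg]
            linarith
      simp only [h1]
      rw [integral_smul_const, ρ.integral_normed, one_smul]
    have h1 : HasFDerivAt (fun y => ψ x + A (y - x)) A x := by
      simp only [map_sub]
      exact (A.hasFDerivAt.sub_const (A x)).const_add _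
    refine h1.congr_of_eventuallyEq ?_
    filter_upwards [Metric.ball_mem_nhds x (sub_pos.2 hr)] with y hy using hlin y hy

lemma tendsto_enorm_smul_zero {F : Type*} [NormedAddCommGroup F] [NormedSpace ℝ F] (a : F)
    {s : ℕ → ℝ} (hs : Tendsto s atTop (𝓝 0)) :
    Tendsto (fun n => ‖s n • a‖ₑ) atTop (𝓝 0) := by
  simpa using (hs.smul_const a).enorm

lemma sub_eq_of_hasFDerivAt_ball {E F : Type*} [NormedAddCommGroup E] [NormedSpace ℝ E]
    [NormedAddCommGroup F] [NormedSpace ℝ F] {g : E → F} {A : E →L[ℝ] F} {x : E} {r : ℝ}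
    (h : ∀ y ∈ Metric.ball x r, HasFDerivAt g A y) {p q : E} (hp : p ∈ Metric.ball x r)
    (hq : q ∈ Metric.ball x r) : g p - g q = A (p - q) := by
  have h1 := (convex_ball x r).norm_image_sub_le_of_norm_hasFDerivWithin_le' (f := g)
    (f' := fun _ => A) (φ := A) (C := 0) (fun y hy => (h y hy).hasFDerivWithinAt) (by simp) hq hp
  rw [zero_mul] at h1
  exact sub_eq_zero.1 (norm_le_zero_iff.1 h1)

end lipschitz

/-! ### Piecewise affine functions belong to `W^{1,∞}_0`; comparison with quasiconvex minorants. -/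

section affsobolev
variable {m N : ℕ} {ι : Type} [Fintype ι] {V : ι → Set (Euc N)} {A : ι → Mat m N}
  {φ : Euc N → Euc m}

/-- Test functions approximating a piecewise affine function on the cube: dilate about the centre
of the cube, then mollify. -/
lemma PWA.exists_testFun_approx (h : PWA (unitCube N) V A φ) {K : ℝ≥0} (hK : LipschitzWith K φ)
    (c : Euc N) (hc : ∀ i, c i = 1 / 2) (n : ℕ) :
    ∃ ψ : Euc N → Euc m, IsTestFun (unitCube N) ψ ∧ LipschitzWith (2 * K) ψ ∧
      (∀ x, ‖ψ x - φ x‖ ≤ 2 * K * (1 / (n + 1)) + K * ‖x - c‖ * (1 / (n + 1))) ∧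
      ∀ i x r, Metric.ball x r ⊆ V i → 2 * (1 / (n + 1)) + ‖x - c‖ * (1 / (n + 1)) < r →
        HasFDerivAt ψ ((1 + 1 / ((n : ℝ) + 1)) • A i) x := by
  set s : ℝ := 1 / ((n : ℝ) + 1) with hs
  have hs0 : 0 < s := by positivity
  have hs1 : s ≤ 1 := by
    rw [hs, div_le_one (by positivity)]; linarith [(Nat.cast_nonneg n : (0 : ℝ) ≤ n)]
  set T : Euc N → Euc N := fun x => x + s • (x - c) with hT
  have hTl : ∀ x y, T x - T y = (1 + s) • (x - y) := by
    intro x y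
    simp only [hT]
    ext i
    simp
    ring
  have hgl : LipschitzWith (2 * K) (φ ∘ T) := by
    refine LipschitzWith.of_dist_le_mul fun x y => ?_
    have h1 := hK.dist_le_mul (T x) (T y)
    rw [dist_eq_norm (T x), hTl, norm_smul, Real.norm_eq_abs, abs_of_pos (by positivity),
      ← dist_eq_norm] at h1
    refine h1.trans ?_
    push_cast
    have : (K : ℝ) * ((1 + s) * dist x y) ≤ K * (2 * dist x y) := by gcongr; linarith
    linarith
  -- The support of `φ ∘ T` lies at distance at least `1/2 - 1/(2(1+s)) ≥ s/4` from the faces, using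
  -- `s ≤ 1`. Mollifying at radius `s / 8` leaves a margin `s / 8`.
  have hε : 0 < s / 8 := by positivity
  obtain ⟨ψ, h1, h2, h3, h4, h5⟩ := hgl.exists_smooth_approx hε
  have hsupp : ∀ x, ψ x ≠ 0 → ∀ i, |x i - 1 / 2| ≤ 1 / 2 - s / 8 := by
    intro x hx i
    by_contra hcon
    refine hx (h4 x fun z hz => h.zero _ fun hz' => hcon ?_)
    obtain ⟨h6, h7⟩ := hz' i
    have h8 : |x i - z i| < s / 8 := by
      rw [mem_ball_iff_norm'] at hz
      exact (PiLp.norm_apply_le (x - z) i).trans_lt hz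
    have h9 : T z i = z i + s * (z i - 1 / 2) := by
      simp [hT, hc]
    rw [h9] at h6 h7
    obtain ⟨h10, h11⟩ := abs_lt.1 h8
    rw [abs_le]
    constructor <;> nlinarith
  have hclosed : IsClosed {x : Euc N | ∀ i, |x i - 1 / 2| ≤ 1 / 2 - s / 8} := by
    rw [ofPred_forall]
    exact isClosed_iInter fun i => isClosed_le (by fun_prop) continuous_const
  have hsub : {x : Euc N | ∀ i, |x i - 1 / 2| ≤ 1 / 2 - s / 8} ⊆ unitCube N := by
    intro x hx i
    obtain ⟨h6, h7⟩ := abs_le.1 (hx i)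
    constructor <;> linarith
  have hts : tsupport ψ ⊆ {x : Euc N | ∀ i, |x i - 1 / 2| ≤ 1 / 2 - s / 8} :=
    closure_minimal (fun x hx => hsupp x hx) hclosed
  refine ⟨ψ, ⟨h1, ?_, hts.trans hsub⟩, h2, fun x => ?_, fun i x r hr hlt => ?_⟩
  · exact Metric.isCompact_of_isClosed_isBounded (isClosed_tsupport ψ)
      ((isBounded_openBox _ _).subset (hts.trans hsub))
  · have h6 := hK.dist_le_mul (T x) x
    have h7 : dist (T x) x = ‖x - c‖ * s := by
      rw [dist_eq_norm]
      simp only [hT, add_sub_cancel_left, norm_smul, Real.norm_eq_abs, abs_of_pos hs0]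
      ring
    rw [h7, dist_eq_norm] at h6
    have h8 := h3 x
    push_cast at h8
    have h9 : 2 * (K : ℝ) * (s / 8) ≤ 2 * K * s := by gcongr; linarith
    calc ‖ψ x - φ x‖ ≤ ‖ψ x - (φ ∘ T) x‖ + ‖φ (T x) - φ x‖ := norm_sub_le_norm_sub_add_norm_sub _ _ _
      _ ≤ _ := by
        rw [mul_assoc (K : ℝ)]
        linarith
  · have hball : ∀ p ∈ Metric.ball x s, T p ∈ Metric.ball x r := by
      intro p hp
      rw [mem_ball_iff_norm] at hp ⊢
      have h6 : T p - x = (1 + s) • (p - x) + s • (x - c) := by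
        simp only [hT]
        ext i
        simp
        ring
      rw [h6]
      refine (norm_add_le _ _).trans_lt (lt_of_le_of_lt ?_ hlt)
      rw [norm_smul, norm_smul, Real.norm_eq_abs, Real.norm_eq_abs, abs_of_pos hs0,
        abs_of_pos (by positivity)]
      have h7 : (1 + s) * ‖p - x‖ ≤ 2 * s := by gcongr; linarith
      linarith
    refine h5 x _ s (by linarith) fun p hp q hq => ?_
    rw [Function.comp_apply, Function.comp_apply,
      sub_eq_of_hasFDerivAt_ball (fun y hy => h.deriv i y (hr hy)) (hball p hp) (hball q hq), hTl,
      map_smul]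
    rfl

theorem PWA.isSobolevOneZero (h : PWA (unitCube N) V A φ) :
    IsSobolevOneZero (unitCube N) φ (fderiv ℝ φ) := by
  have : ProperSpace (Mat m N) := FiniteDimensional.proper ℝ (Mat m N)
  obtain ⟨K, hK⟩ := h.lip
  let c : Euc N := WithLp.toLp 2 fun _ => 1 / 2
  choose ψ hψ1 hψ2 hψ3 hψ4 using h.exists_testFun_approx hK c fun _ => rfl
  obtain ⟨R, hR⟩ := (isBounded_openBox (fun _ : Fin N => 0) (fun _ => 1)).subset_closedBall c
  have hs := tendsto_one_div_add_atTop_nhds_zero_nat (𝕜 := ℝ)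
  have hae : ∀ᵐ x ∂volume.restrict (unitCube N), x ∈ ⋃ i, V i := by
    rw [ae_restrict_iff' isOpen_unitCube.measurableSet]
    refine measure_mono_null (fun x hx => ?_) h.null
    simp only [mem_compl_iff, mem_ofPred_eq, Classical.not_imp] at hx
    exact hx
  refine ⟨ψ, hψ1, ?_, ?_⟩
  · have hb : ∀ n, eLpNorm (fun x => ψ n x - φ x) 1 (volume.restrict (unitCube N)) ≤
        ENNReal.ofReal (2 * K * (1 / (n + 1)) + K * R * (1 / (n + 1))) := by
      intro n
      refine (eLpNorm_le_of_ae_bound (C := 2 * K * (1 / (n + 1)) + K * R * (1 / (n + 1))) ?_).trans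
        (le_of_eq ?_)
      · rw [ae_restrict_iff' isOpen_unitCube.measurableSet]
        refine Eventually.of_forall fun x hx => (hψ3 n x).trans ?_
        have : ‖x - c‖ ≤ R := by
          have := hR hx
          rwa [mem_closedBall_iff_norm] at this
        gcongr
      · simp [volume_unitCube]
    have hlim : Tendsto (fun n : ℕ => ENNReal.ofReal (2 * K * (1 / (n + 1)) + K * R * (1 / (n + 1))))
        atTop (𝓝 0) := by
      have := ((hs.const_mul (2 * K : ℝ)).add (hs.const_mul (K * R : ℝ)))
      simpa using ENNReal.tendsto_ofReal this
    exact tendsto_of_tendsto_of_tendsto_of_le_of_le tendsto_const_nhds hlim (fun _ => zero_le) hb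
  · simp only [eLpNorm_one_eq_lintegral_enorm]
    have hlim : Tendsto (fun n => ∫⁻ x in unitCube N, ‖fderiv ℝ (ψ n) x - fderiv ℝ φ x‖ₑ) atTop
        (𝓝 (∫⁻ _ in unitCube N, 0)) := by
      -- The bound is `2K` for the gradient of `ψ n` plus `K` for that of `φ`.
      refine tendsto_lintegral_of_dominated_convergence (fun _ => ENNReal.ofReal (3 * K))
        (fun n => ((measurable_fderiv ℝ (ψ n)).sub (measurable_fderiv ℝ φ)).enorm) (fun n => ?_) ?_ ?_
      · refine Eventually.of_forall fun x => ?_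
        change ‖fderiv ℝ (ψ n) x - fderiv ℝ φ x‖ₑ ≤ ENNReal.ofReal (3 * K)
        rw [← ofReal_norm]
        refine ENNReal.ofReal_le_ofReal ((norm_sub_le _ _).trans ?_)
        have h1 := norm_fderiv_le_of_lipschitz ℝ (hψ2 n) (x₀ := x)
        have h2 := norm_fderiv_le_of_lipschitz ℝ hK (x₀ := x)
        push_cast at h1
        linarith
      · rw [setLIntegral_const, volume_unitCube, mul_one]
        exact ENNReal.ofReal_ne_top
      · filter_upwards [hae] with x hx
        obtain ⟨i, hi⟩ := mem_iUnion.1 hx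
        obtain ⟨r, hr, hrV⟩ := Metric.isOpen_iff.1 (h.isOpen i) x hi
        have h1 : ∀ᶠ n : ℕ in atTop,
            2 * (1 / ((n : ℝ) + 1)) + ‖x - c‖ * (1 / ((n : ℝ) + 1)) < r := by
          have := ((hs.const_mul 2).add (hs.const_mul ‖x - c‖))
          simp only [mul_zero, add_zero] at this
          exact this.eventually_lt_const hr
        -- Near a point of `V i` the approximating gradient is eventually `(1 + 1/(n+1)) A i`, so
        -- this is the error.
        have h2 : Tendsto (fun n : ℕ => ‖(1 / ((n : ℝ) + 1)) • A i‖ₑ) atTop (𝓝 0) :=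
          tendsto_enorm_smul_zero (A i) hs
        refine h2.congr' ?_
        filter_upwards [h1] with n hn
        rw [(hψ4 n i x r hrV hn).fderiv, (h.deriv i x hi).fderiv, add_smul _ _ (A i),
          one_smul ℝ (A i), add_sub_cancel_left]
    simpa using hlim

theorem PWA.isSobolevInftyZero (h : PWA (unitCube N) V A φ) :
    IsSobolevInftyZero (unitCube N) φ (fderiv ℝ φ) := by
  have : ProperSpace (Mat m N) := FiniteDimensional.proper ℝ (Mat m N)
  have hfin : IsFiniteMeasure (volume.restrict (unitCube N)) :=
    ⟨by simp [volume_unitCube]⟩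
  obtain ⟨K, hK⟩ := h.lip
  have hcs : HasCompactSupport φ := by
    refine HasCompactSupport.intro (K := closure (unitCube N)) ?_ fun x hx =>
      h.zero x fun h' => hx (subset_closure h')
    exact (isBounded_openBox _ _).isCompact_closure
  obtain ⟨C, hC⟩ := hcs.exists_bound_of_continuous hK.continuous
  have h1 : MemLp φ ∞ (volume.restrict (unitCube N)) :=
    memLp_top_of_bound hK.continuous.aestronglyMeasurable C (Eventually.of_forall hC)
  have h2 : MemLp (fderiv ℝ φ) ∞ (volume.restrict (unitCube N)) :=
    memLp_top_of_bound (measurable_fderiv ℝ φ).aestronglyMeasurable K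
      (Eventually.of_forall fun x => norm_fderiv_le_of_lipschitz ℝ hK)
  have h3 := h.isSobolevOneZero
  exact ⟨⟨h1, h2, fun η hη v => h3.integral_fderiv_smul (h1.integrable le_top)
    (h2.integrable le_top) (hη.1.of_le (by simp)) hη.2.1 v⟩, h3⟩

theorem IsQuasiconvex.le_sum {g : Mat m N → ℝ≥0∞} (hg : IsQuasiconvex g)
    (h : PWA (unitCube N) V A φ) (ξ : Mat m N) : g ξ ≤ ∑ i, volume (V i) * g (ξ + A i) := by
  have h1 := hg.le_average ξ _ isOpen_unitCube unitCube_nonempty (isBounded_openBox _ _)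
    (volume_frontier_openBox _ _) φ _ h.isSobolevInftyZero
  rwa [volume_unitCube, inv_one, one_mul, h.lintegral (fun B => g (ξ + B))] at h1

theorem IsQuasiconvex.le_zEnv {g W : Mat m N → ℝ≥0∞} (hN : 1 ≤ N) (hg : IsQuasiconvex g)
    (hgW : g ≤ W) : g ≤ ZEnv W := by
  intro ξ
  refine le_of_forall_gt fun c hc => ?_
  obtain ⟨k, V, A, φ, hP, hlt⟩ := exists_pwa_zEnv hN W ξ hc
  refine ((hg.le_sum hP ξ).trans ?_).trans_lt hlt
  gcongr with i
  exact hgW _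

end affsobolev

/-! ### Convex minorants and the case `N = 1`. -/

/-- Jensen's inequality for convex functions with values in `[0,∞]`. -/
lemma ConvexOn.map_sum_le_ennreal {E ι : Type*} [AddCommMonoid E] [Module ℝ≥0 E] {g : E → ℝ≥0∞}
    (hg : ConvexOn ℝ≥0 univ g) (x : ι → E) (S : Finset ι) (w : ι → ℝ≥0) (hw : ∑ i ∈ S, w i = 1) :
    g (∑ i ∈ S, w i • x i) ≤ ∑ i ∈ S, w i * g (x i) := by
  classical
  induction S using Finset.induction_on generalizing w with
  | empty => simp at hw
  | insert i S hi ih =>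
    rw [Finset.sum_insert hi] at hw ⊢
    rw [Finset.sum_insert hi]
    by_cases ht : ∑ j ∈ S, w j = 0
    · have h0 : ∀ j ∈ S, w j = 0 := fun j hj => (Finset.sum_eq_zero_iff.1 ht) j hj
      rw [ht, add_zero] at hw
      rw [Finset.sum_eq_zero fun j hj => by rw [h0 j hj, zero_smul], hw, one_smul, add_zero]
      simp
    · set t := ∑ j ∈ S, w j with htdef
      have h1 : ∑ j ∈ S, w j / t = 1 := by
        rw [← Finset.sum_div, div_self ht]
      have h2 : ∑ j ∈ S, w j • x j = t • ∑ j ∈ S, (w j / t) • x j := by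
        rw [Finset.smul_sum]
        refine Finset.sum_congr rfl fun j _ => ?_
        rw [smul_smul, mul_div_cancel₀ _ ht]
      have h3 : ∑ j ∈ S, (w j : ℝ≥0∞) * g (x j) = t * ∑ j ∈ S, ((w j / t : ℝ≥0) : ℝ≥0∞) * g (x j) := by
        rw [Finset.mul_sum]
        refine Finset.sum_congr rfl fun j _ => ?_
        rw [← mul_assoc, ← ENNReal.coe_mul, mul_div_cancel₀ _ ht]
      rw [h2, h3]
      refine (hg.2 (mem_univ _) (mem_univ _) zero_le zero_le hw).trans ?_
      simp only [ENNReal.smul_def, smul_eq_mul]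
      gcongr
      exact ih _ h1

section convex
variable {m N : ℕ} {ι : Type} [Fintype ι] {V : ι → Set (Euc N)} {A : ι → Mat m N}
  {φ : Euc N → Euc m}

lemma PWA.measure_ne_top (h : PWA (unitCube N) V A φ) (i : ι) : volume (V i) ≠ ⊤ :=
  measure_ne_top_of_subset (h.subset i) (by rw [volume_unitCube]; exact ENNReal.one_ne_top)

/-- The mean of the gradient is zero: integrate by parts against a cut-off `η` equal to `1` on the
cube, which is permitted because such test functions need not vanish near the boundary. -/
lemma PWA.sum_smul_grad_eq_zero (h : PWA (unitCube N) V A φ) :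
    ∑ i, (volume (V i)).toReal • A i = 0 := by
  refine ContinuousLinearMap.ext fun v => ?_
  have hS := h.isSobolevInftyZero
  have hfin : IsFiniteMeasure (volume.restrict (unitCube N)) :=
    ⟨by simp [volume_unitCube]⟩
  have hφi : IntegrableOn φ (unitCube N) := hS.1.memLp.integrable le_top
  have hGi : IntegrableOn (fderiv ℝ φ) (unitCube N) := hS.1.memLp_grad.integrable le_top
  obtain ⟨R, hR, hYR⟩ := (isBounded_openBox (fun _ : Fin N => 0) (fun _ => 1)).subset_ball_lt 0 0
  let η : ContDiffBump (0 : Euc N) := ⟨R, R + 1, hR, by linarith⟩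
  have h1 := hS.2.integral_fderiv_smul hφi hGi (η := η) η.contDiff η.hasCompactSupport v
  have h2 : ∫ x in unitCube N, (fderiv ℝ η x v) • φ x = 0 := by
    rw [setIntegral_congr_fun (g := fun _ => 0) isOpen_unitCube.measurableSet]
    · simp
    intro x hx
    have h3 : (η : Euc N → ℝ) =ᶠ[𝓝 x] fun _ => 1 := η.eventuallyEq_one_of_mem_ball (hYR hx)
    simp [h3.fderiv_eq]
  have h3 : ∫ x in unitCube N, η x • fderiv ℝ φ x v = ∫ x in ⋃ i, V i, fderiv ℝ φ x v := by
    rw [setIntegral_congr_set h.measure_iUnion]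
    refine setIntegral_congr_fun isOpen_unitCube.measurableSet fun x hx => ?_
    have h4 : η x = 1 := η.one_of_mem_closedBall (Metric.ball_subset_closedBall (hYR hx))
    simp [h4]
  have h4 : ∀ i, ∫ x in V i, fderiv ℝ φ x v = (volume (V i)).toReal • A i v := by
    intro i
    rw [setIntegral_congr_fun (g := fun _ => A i v) (h.isOpen i).measurableSet
      fun x hx => by simp only [(h.deriv i x hx).fderiv], setIntegral_const]
    rfl
  have h5 : ∀ i, IntegrableOn (fun x => fderiv ℝ φ x v) (V i) := fun i =>
    (integrableOn_congr_fun (f := fun _ => A i v) (fun x hx => by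
      simp only [(h.deriv i x hx).fderiv]) (h.isOpen i).measurableSet).1
      (by rw [integrableOn_const_iff]; exact Or.inr (h.measure_ne_top i).lt_top)
  rw [h2, h3, integral_iUnion_fintype (fun i => (h.isOpen i).measurableSet) h.disj h5] at h1
  simp only [h4] at h1
  rw [sum_apply]
  exact neg_eq_zero.1 h1.symm

theorem ConvexOn.le_sum_pwa {g : Mat m N → ℝ≥0∞} (hg : ConvexOn ℝ≥0 univ g)
    (h : PWA (unitCube N) V A φ) (ξ : Mat m N) : g ξ ≤ ∑ i, volume (V i) * g (ξ + A i) := by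
  have hw : ∑ i, (volume (V i)).toNNReal = 1 := by
    rw [← ENNReal.toNNReal_sum fun i _ => h.measure_ne_top i, h.sum_measure, volume_unitCube]
    rfl
  have h1 := hg.map_sum_le_ennreal (fun i => ξ + A i) Finset.univ _ hw
  have h2 : ∑ i, (volume (V i)).toNNReal • (ξ + A i) = ξ := by
    simp only [smul_add, Finset.sum_add_distrib]
    rw [← Finset.sum_smul, hw, one_smul]
    have h3 : ∑ i, (volume (V i)).toNNReal • A i = ∑ i, (volume (V i)).toReal • A i := rfl
    rw [h3, h.sum_smul_grad_eq_zero, add_zero]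
  rw [h2] at h1
  refine h1.trans (le_of_eq (Finset.sum_congr rfl fun i _ => ?_))
  rw [ENNReal.coe_toNNReal (h.measure_ne_top i)]

theorem ConvexOn.le_zEnv {g W : Mat m N → ℝ≥0∞} (hN : 1 ≤ N) (hg : ConvexOn ℝ≥0 univ g)
    (hgW : g ≤ W) : g ≤ ZEnv W := by
  intro ξ
  refine le_of_forall_gt fun c hc => ?_
  obtain ⟨k, V, A, φ, hP, hlt⟩ := exists_pwa_zEnv hN W ξ hc
  refine ((hg.le_sum_pwa hP ξ).trans ?_).trans_lt hlt
  gcongr with i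
  exact hgW _

/-- With a single column, every difference `y - x` is of the form `a ⊗ e_0`, so the restricted
convexity is full convexity. -/
theorem AffQC.convexOn {f : Mat m 1 → ℝ≥0∞} (hf : AffQC f) (hfin : ∀ ξ, f ξ < ⊤) :
    ConvexOn ℝ≥0 univ f := by
  refine ⟨convex_univ, fun x _ y _ a b _ _ hab => ?_⟩
  have hab' : (b : ℝ) + a = 1 := by
    rw [add_comm]; exact_mod_cast hab
  have h1 := hf.convex_rankOne hfin x ((y - x) (EuclideanSpace.single 0 1)) 0 b.2 a.2 hab'
  have h2 : rankOne ((y - x) (EuclideanSpace.single 0 1)) 0 = y - x := by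
    have := rankOne_sum_col (y - x)
    rwa [Fin.sum_univ_one] at this
  have h3 : x + (b : ℝ) • (y - x) = a • x + b • y := by
    change x + (b : ℝ) • (y - x) = (a : ℝ) • x + (b : ℝ) • y
    rw [show (a : ℝ) = 1 - b by linarith, smul_sub (b : ℝ) y x, sub_smul 1 (b : ℝ) x,
      one_smul ℝ x]
    abel
  rw [h2, add_sub_cancel] at h1
  change f (x + (b : ℝ) • (y - x)) ≤ _ at h1
  rw [h3] at h1
  simpa [ENNReal.smul_def] using h1

end convex

theorem proposition1p9 (m N : ℕ) (hm : 1 ≤ m) (hN : 1 ≤ N)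
    (W : Mat m N → ℝ≥0∞) (hW : Measurable W) (hZ : ∀ ξ, ZEnv W ξ < ⊤) :
    IsGreatest (quasiconvexMinorants W) (QEnv W) ∧
    IsGreatest (quasiconvexMinorants (ZEnv W)) (QEnv (ZEnv W)) ∧
    QEnv W = QEnv (ZEnv W) ∧ QEnv (ZEnv W) = ZEnv W ∧
    (N = 1 → ZEnv W = lscConvexEnv W) := by
  have hA : AffQC (ZEnv W) := affQC_zEnv hN W hZ
  have hQ : IsQuasiconvex (ZEnv W) := hA.isQuasiconvex hZ
  have h1 : IsGreatest (quasiconvexMinorants W) (ZEnv W) :=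
    ⟨⟨hQ, zEnv_le W⟩, fun g hg => hg.1.le_zEnv hN hg.2⟩
  have h2 : IsGreatest (quasiconvexMinorants (ZEnv W)) (ZEnv W) :=
    ⟨⟨hQ, le_rfl⟩, fun g hg => hg.2⟩
  have e1 : QEnv W = ZEnv W := h1.isLUB.sSup_eq
  have e2 : QEnv (ZEnv W) = ZEnv W := h2.isLUB.sSup_eq
  refine ⟨e1 ▸ h1, ?_, e1.trans e2.symm, e2, ?_⟩
  · rw [e2]; exact h2
  · rintro rfl
    refine le_antisymm (le_sSup ⟨(hA.continuous hZ).lowerSemicontinuous, hA.convexOn hZ,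
      zEnv_le W⟩) (sSup_le fun g hg => hg.2.1.le_zEnv hN hg.2.2)
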